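/- **Setup.** Let $\operatorname{Im}\tau>0$, $q=e^{2\pi i\tau}$, and let $$\vartheta(x)=(x^{1/2}-x^{-1/2})\,\varphi(qx)\,\varphi(q/x),\qquad \varphi(x)=\prod_{s\ge 0}(1-q^sx).$$ All multiplicative variables are written $x=e^{2\pi iu}$, with $x^{1/2}=e^{\pi iu}$, and functions are regarded as functions of the additive variables $u$ (so products and quotients of arguments correspond to sums and differences of the additive variables). *Weight functions.* Let $n,N\ge 0$ and $\lambda\in\mathbb Z_{\ge0}^N$ with $\sum_k\lambda_k=n$; put $\lambda^{(k)}=\lambda_1+\dots+\lambda_k$. Let $\mathcal I_\lambda$ be the set of ordered partitions $I=(I_1,\dots,I_N)$ of $\{1,\dots,n\}$ with $|I_k|=\lambda_k$ (blocks may be empty). For $I\in\mathcal I_\lambda$ write $I_1\cup\dots\cup I_k=\{i^{(k)}_1<\dots<i^{(k)}_{\lambda^{(k)}}\}$, let $j(I,k,a)$ be the index with $i^{(k)}_a\in I_{j(I,k,a)}$, and let $p_{I,j}(m)=|I_j\cap\{1,\dots,m-1\}|$. Let $\boldsymbol\mu=(\mu_1,\dots,\mu_N)$, let $h$ be a parameter,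 and let $\boldsymbol t=(t^{(k)}_a)$, $1\le k\le N-1$, $1\le a\le\lambda^{(k)}$, and $\boldsymbol z=(z_1,\dots,z_n)$ be variables, with $t^{(N)}_c=z_c$. Put $$d_{I,k,a}=h^{1+p_{I,j}(i^{(k)}_a)-p_{I,k+1}(i^{(k)}_a)}\,\mu_{k+1}/\mu_j,\qquad j=j(I,k,a),$$ $$\psi_{I,k,a,c}(x)=\begin{cases}\vartheta(hx), & i^{(k+1)}_c<i^{(k)}_a,\\ \vartheta(x\,d_{I,k,a})/\vartheta(d_{I,k,a}), & i^{(k+1)}_c=i^{(k)}_a,\\ \vartheta(x), & i^{(k+1)}_c>i^{(k)}_a,\end{cases}$$ $$U_I=\prod_{k=1}^{N-1}\prod_{a=1}^{\lambda^{(k)}}\Bigl(\prod_{c=1}^{\lambda^{(k+1)}}\psi_{I,k,a,c}\bigl(t^{(k+1)}_c/t^{(k)}_a\bigr)\prod_{b=a+1}^{\lambda^{(k)}}\frac{\vartheta(h\,t^{(k)}_b/t^{(k)}_a)}{\vartheta(t^{(k)}_b/t^{(k)}_a)}\Bigr),$$ $$W^{\rm ell}_I(\boldsymbol t,\boldsymbol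 z,h,\boldsymbol\mu)=\vartheta(h)^{\lambda^{(1)}+\dots+\lambda^{(N-1)}}\ \mathrm{Sym}_{t^{(1)}}\cdots\mathrm{Sym}_{t^{(N-1)}}U_I,$$ where $\mathrm{Sym}_{t^{(k)}}$ is the (unnormalized) sum over all permutations of $t^{(k)}_1,\dots,t^{(k)}_{\lambda^{(k)}}$. For $\sigma\in S_n$ put $\sigma(I)=(\sigma(I_1),\dots,\sigma(I_N))$ and $$W^{\rm ell}_{\sigma,I}(\boldsymbol t,\boldsymbol z,h,\boldsymbol\mu)=W^{\rm ell}_{\sigma^{-1}(I)}(\boldsymbol t,z_{\sigma(1)},\dots,z_{\sigma(n)},h,\boldsymbol\mu).$$ *$R$-matrix.* The nonzero entries of the elliptic dynamical $R$-matrix $\mathcal R(x,\boldsymbol\mu)$ are $$\mathcal R_{jj}^{jj}=1,\qquad \mathcal R_{kj}^{jk}=\frac{\vartheta(x\mu_j/\mu_k)\,\vartheta(h)}{\vartheta(xh)\,\vartheta(\mu_j/\mu_k)}\quad(j\neq k),$$ $$\mathcal R_{jk}^{jk}=\frac{\vartheta(x)\,\vartheta(h\mu_j/\mu_k)\,\vartheta(h\mu_k/\mu_j)}{\vartheta(xh)\,\vartheta(\mu_j/\mu_k)\,\vartheta(\mu_k/\mu_j)},\qquad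 \mathcal R_{kj}^{kj}=\frac{\vartheta(x)}{\vartheta(xh)}\qquad(j<k).$$ Let $s_{i,j}\in S_n$ be the transposition of $i$ and $j$, and $\boldsymbol\mu^{(i)}_I=(h^{-p_{I,1}(i)}\mu_1,\dots,h^{-p_{I,N}(i)}\mu_N)$. **Theorem 2.2.** Let $I\in\mathcal I_\lambda$, $\sigma\in S_n$, $1\le i\le n-1$, and let $a,b$ be such that $\sigma(i)\in I_a$ and $\sigma(i+1)\in I_b$. (1) If $a=b$, then $W^{\rm ell}_{\sigma s_{i,i+1},I}=W^{\rm ell}_{\sigma,I}$. (2) If $a\neq b$, then $$W^{\rm ell}_{\sigma s_{i,i+1},I}=\mathcal R_{ab}^{ab}\bigl(z_{\sigma(i)}/z_{\sigma(i+1)},\boldsymbol\mu^{(i)}_{\sigma^{-1}(I)}\bigr)\,W^{\rm ell}_{\sigma,I}+\mathcal R_{ab}^{ba}\bigl(z_{\sigma(i)}/z_{\sigma(i+1)},\boldsymbol\mu^{(i)}_{\sigma^{-1}(I)}\bigr)\,W^{\rm ell}_{\sigma,\,s_{\sigma(i),\sigma(i+1)}(I)}.$$ These are identities of meromorphic functions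 of the additive variables. Explicitly, they hold at every point at which none of the denominators of the expressions above for the weight functions and $R$-matrix entries that occur in the identity vanishes: $\vartheta(t^{(k)}_b/t^{(k)}_a)$ for $1\le k\le N-1$ and $a\ne b$; $\vartheta(d_{J,k,a})$ for $J=\sigma^{-1}(I)$ and, in (2), also for $J=(\sigma s_{i,i+1})^{-1}(I)$; and, in (2), $\vartheta(h z_{\sigma(i)}/z_{\sigma(i+1)})$ and $\vartheta(\mu'_a/\mu'_b)$ with $\boldsymbol\mu'=\boldsymbol\mu^{(i)}_{\sigma^{-1}(I)}$. -/

import Mathlib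

open scoped BigOperators

/-!
# Elliptic weight functions and the elliptic dynamical `R`-matrix

All multiplicative variables are written in exponential coordinates: a multiplicative variable `x`
is `exp (2πi u)` and the additive variable `u` is what the functions below take as argument, with
`x^{1/2} = exp (πi u)` and `q = exp (2πi τ)`.  So `t`, `z`, `η`, `μ` below are the logarithms of
the multiplicative variables `t`, `z`, `h`, `μ`, products become sums and quotients become
differences.  Blocks are numbered `0, …, N - 1` and elements `0, …, n - 1`, whereas the levels
`k = 1, …, N - 1` and the partial sums `λ^{(k)}` keep the usual numbering.
-/

namespace EllipticWeight

noncomputable section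

/-- `φ(x) = ∏_{s ≥ 0} (1 - q^s x)`, `q = exp (2πi τ)`. -/
def eulerProd (τ x : ℂ) : ℂ :=
  ∏' s : ℕ, (1 - Complex.exp (2 * Real.pi * Complex.I * τ) ^ s * x)

/-- The theta function `(x^{1/2} - x^{-1/2}) φ(q x) φ(q / x)` with `x = exp (2πi u)`. -/
def theta (τ u : ℂ) : ℂ :=
  (Complex.exp (Real.pi * Complex.I * u) - Complex.exp (-(Real.pi * Complex.I * u)))
    * eulerProd τ (Complex.exp (2 * Real.pi * Complex.I * τ) *
        Complex.exp (2 * Real.pi * Complex.I * u))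
    * eulerProd τ (Complex.exp (2 * Real.pi * Complex.I * τ) /
        Complex.exp (2 * Real.pi * Complex.I * u))

/-- The elliptic dynamical `R`-matrix: `ellR τ η x μ l₁ l₂ u₁ u₂` is the entry with lower indices
`l₁, l₂` and upper indices `u₁, u₂`, at spectral parameter `x` and dynamical parameters `μ`. -/
def ellR {N : ℕ} (τ η x : ℂ) (μ : Fin N → ℂ) (l₁ l₂ u₁ u₂ : Fin N) : ℂ :=
  if l₁ = l₂ then
    if u₁ = l₁ ∧ u₂ = l₂ then 1 else 0
  else if u₁ = l₁ ∧ u₂ = l₂ then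
    if u₁ < u₂ then
      (theta τ x * theta τ (η + μ u₁ - μ u₂) * theta τ (η + μ u₂ - μ u₁)) /
        (theta τ (x + η) * theta τ (μ u₁ - μ u₂) * theta τ (μ u₂ - μ u₁))
    else theta τ x / theta τ (x + η)
  else if u₁ = l₂ ∧ u₂ = l₁ then
    (theta τ (x + μ u₁ - μ u₂) * theta τ η) / (theta τ (x + η) * theta τ (μ u₁ - μ u₂))
  else 0

/-- `λ^{(k)} = λ_1 + … + λ_k`. -/
def partialSum {N : ℕ} (lam : Fin N → ℕ) (k : ℕ) : ℕ :=
  ∑ j ∈ Finset.univ.filter (fun j : Fin N => (j : ℕ) < k), lam j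

/-- Ordered partitions `I = (I_1, …, I_N)` of an `n`-element set into (possibly empty) blocks with
`|I_k| = λ_k`, given by the map that sends an element to the index of its block. -/
structure BlockPartition (n : ℕ) {N : ℕ} (lam : Fin N → ℕ) where
  /-- The index of the block that contains a given element. -/
  color : Fin n → Fin N
  card_color : ∀ j, (Finset.univ.filter fun m => color m = j).card = lam j

/-- The variables `t^{(k)}_a`, `1 ≤ k ≤ N - 1`, `1 ≤ a ≤ λ^{(k)}`. -/
abbrev Vars {N : ℕ} (lam : Fin N → ℕ) : Type :=
  (k : Finset.Ico 1 N) → Fin (partialSum lam k) → ℂ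

/-- The index of the block `I_{k+1}`, for a level `1 ≤ k ≤ N - 1`. -/
def nextBlock {N : ℕ} (k : Finset.Ico 1 N) : Fin N :=
  ⟨k, (Finset.mem_Ico.1 k.2).2⟩

namespace BlockPartition

variable {n N : ℕ} {lam : Fin N → ℕ}

/-- The block `I_j`. -/
def block (I : BlockPartition n lam) (j : Fin N) : Finset (Fin n) :=
  Finset.univ.filter fun m => I.color m = j

/-- The image `σ(I) = (σ(I_1), …, σ(I_N))`. -/
def perm (σ : Equiv.Perm (Fin n)) (I : BlockPartition n lam) : BlockPartition n lam where
  color := fun m => I.color (σ⁻¹ m)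
  card_color := fun j => by
    rw [← I.card_color j]
    refine Finset.card_bij (fun m _ => σ⁻¹ m) ?_ ?_ ?_
    · intro m hm
      simpa using hm
    · intro m _ m' _ h
      exact (σ⁻¹).injective h
    · intro m hm
      exact ⟨σ m, by simpa using hm, by simp⟩

/-- The union `I_1 ∪ … ∪ I_k`. -/
def upTo (I : BlockPartition n lam) (k : ℕ) : Finset (Fin n) :=
  Finset.univ.filter fun m => (I.color m : ℕ) < k

theorem card_upTo (I : BlockPartition n lam) (k : ℕ) : (I.upTo k).card = partialSum lam k := by
  classical
  have h : ∀ m ∈ I.upTo k, I.color m ∈ Finset.univ.filter fun j : Fin N => (j : ℕ) < k := by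
    intro m hm
    simpa [upTo] using hm
  rw [Finset.card_eq_sum_card_fiberwise h, partialSum]
  refine Finset.sum_congr rfl fun j hj => ?_
  rw [← I.card_color j]
  congr 1
  ext m
  simp only [upTo, Finset.mem_filter, Finset.mem_univ, true_and] at hj ⊢
  exact ⟨fun h => h.2, fun h => ⟨h ▸ hj, h⟩⟩

theorem partialSum_le (I : BlockPartition n lam) (k : ℕ) : partialSum lam k ≤ n := by
  rw [← I.card_upTo k]
  simpa using (I.upTo k).card_le_univ

/-- The element `i^{(k)}_a`, where `I_1 ∪ … ∪ I_k = {i^{(k)}_1 < i^{(k)}_2 < …}`. -/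
def elt (I : BlockPartition n lam) (k : ℕ) (a : Fin (partialSum lam k)) : Fin n :=
  (I.upTo k).orderEmbOfFin (I.card_upTo k) a

/-- `p_{I,j}(m) = |I_j ∩ {1, …, m - 1}|`. -/
def p (I : BlockPartition n lam) (j : Fin N) (m : Fin n) : ℕ :=
  ((I.block j).filter fun m' => m' < m).card

/-- The variable `t^{(k)}_c`, where `t^{(N)}_c = z_c`. -/
def levelVar (I : BlockPartition n lam) (t : Vars lam) (z : Fin n → ℂ) (k : ℕ)
    (c : Fin (partialSum lam k)) : ℂ :=
  if h : k ∈ Finset.Ico 1 N then t ⟨k, h⟩ c else z (Fin.castLE (I.partialSum_le k) c)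

/-- The logarithm of
`h^{1 + p_{I,j}(i^{(k)}_a) - p_{I,k+1}(i^{(k)}_a)} μ_{k+1} / μ_j`, `j = j(I,k,a)` being the index
of the block that contains `i^{(k)}_a`. -/
def dynShift (I : BlockPartition n lam) (η : ℂ) (μ : Fin N → ℂ) (k : Finset.Ico 1 N)
    (a : Fin (partialSum lam k)) : ℂ :=
  (1 + (I.p (I.color (I.elt k a)) (I.elt k a) : ℂ) - (I.p (nextBlock k) (I.elt k a) : ℂ)) * η
    + μ (nextBlock k) - μ (I.color (I.elt k a))

/-- The factor `ψ_{I,k,a,c}`. -/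
def psi (I : BlockPartition n lam) (τ η : ℂ) (μ : Fin N → ℂ) (k : Finset.Ico 1 N)
    (a : Fin (partialSum lam k)) (c : Fin (partialSum lam (k + 1))) (x : ℂ) : ℂ :=
  if I.elt (k + 1) c < I.elt k a then theta τ (η + x)
  else if I.elt (k + 1) c = I.elt k a then
    theta τ (x + I.dynShift η μ k a) / theta τ (I.dynShift η μ k a)
  else theta τ x

/-- The function `U_I`. -/
def U (I : BlockPartition n lam) (τ η : ℂ) (μ : Fin N → ℂ) (t : Vars lam) (z : Fin n → ℂ) : ℂ :=
  ∏ k : Finset.Ico 1 N, ∏ a : Fin (partialSum lam k),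
    ((∏ c : Fin (partialSum lam (k + 1)),
        I.psi τ η μ k a c (I.levelVar t z (k + 1) c - t k a)) *
      ∏ b ∈ Finset.univ.filter (fun b : Fin (partialSum lam k) => a < b),
        theta τ (η + t k b - t k a) / theta τ (t k b - t k a))

end BlockPartition

/-- `Sym_{t^{(1)}} ⋯ Sym_{t^{(N-1)}}`: the sum over all independent permutations of the variables
`t^{(k)}_1, t^{(k)}_2, …`, for `k = 1, …, N - 1`. -/
def symmetrize {N : ℕ} {lam : Fin N → ℕ} (f : Vars lam → ℂ) (t : Vars lam) : ℂ :=
  ∑ π : (k : Finset.Ico 1 N) → Equiv.Perm (Fin (partialSum lam k)), f fun k a => t k (π k a)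

namespace BlockPartition

variable {n N : ℕ} {lam : Fin N → ℕ}

/-- The elliptic weight function `W_I`. -/
def W (I : BlockPartition n lam) (τ η : ℂ) (μ : Fin N → ℂ) (t : Vars lam) (z : Fin n → ℂ) : ℂ :=
  theta τ η ^ (∑ k : Finset.Ico 1 N, partialSum lam k) *
    symmetrize (fun t' => I.U τ η μ t' z) t

/-- The elliptic weight function `W_{σ,I}(t, z) = W_{σ⁻¹(I)}(t, z_{σ(1)}, …, z_{σ(n)})`. -/
def Wσ (σ : Equiv.Perm (Fin n)) (I : BlockPartition n lam) (τ η : ℂ) (μ : Fin N → ℂ)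
    (t : Vars lam) (z : Fin n → ℂ) : ℂ :=
  (I.perm σ⁻¹).W τ η μ t (fun m => z (σ m))

/-- The shifted dynamical parameters `μ_I^{(m)} = (h^{-p_{I,1}(m)} μ_1, …, h^{-p_{I,N}(m)} μ_N)`. -/
def shiftedμ (I : BlockPartition n lam) (m : Fin n) (η : ℂ) (μ : Fin N → ℂ) : Fin N → ℂ :=
  fun j => μ j - (I.p j m : ℂ) * η

/-- No denominator of `W_I` that depends on `h, μ` only vanishes. -/
def DynRegular (I : BlockPartition n lam) (τ η : ℂ) (μ : Fin N → ℂ) : Prop :=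
  ∀ (k : Finset.Ico 1 N) (a : Fin (partialSum lam k)), theta τ (I.dynShift η μ k a) ≠ 0

end BlockPartition

/-- No denominator `θ(t^{(k)}_b / t^{(k)}_a)` of a weight function vanishes. -/
def OffDiagonal {N : ℕ} {lam : Fin N → ℕ} (τ : ℂ) (t : Vars lam) : Prop :=
  ∀ (k : Finset.Ico 1 N) (a b : Fin (partialSum lam k)), a ≠ b → theta τ (t k b - t k a) ≠ 0

end

end EllipticWeight

open EllipticWeight

namespace EllipticWeight

/-! ### The theta function -/

/-! Passing to J = σ⁻¹(I) turns the claim into one about exchanging the neighbouring positions i and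
i' = i + 1. Attach the variables of level k to the elements of J_1 ∪ … ∪ J_k. No third element lies
between i and i', so the product of all factors of U_J that involve a third element does not change
when the variables of i and i' are exchanged at some level, nor when J is replaced by its image
under the exchange, nor when z_i and z_i' are exchanged (`outerFactor_eq_of_perm`,
`outerProd_perm_swap`). The symmetrization can therefore be averaged over the 2^(N-1) choices of
exchanges, one for each level; the outer product splits off, and what remains is `chain`, in effect
a weight function of two elements with prescribed dynamical shifts (`two_pow_mul_symmetrize_U`).

For two elements the proof is an induction on the level. If the colours agree, the chain stays
symmetric in the variables of the next level (`exchange_same`). If they are α < β, the R-matrix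
relations for both orders of the colours are proved together, because the induction step mixes them.
They start at level β, where the second element is about to appear (`exchange_base_left`,
`exchange_base_right`), and pass from level to level by `exchange_step`. This works because above
level β the two shifts differ by an amount δ independent of the level, namely the difference of the
shifted dynamical parameters in the R-matrix.

The identities behind these steps are combinations of three-term relations. The functions θ(x +
y)θ(x - y) of x lie in a space of dimension at most two, so the antisymmetric 4 × 4 matrix with
entries θ(p_i + p_j)θ(p_i - p_j) is singular. Its determinant is the square of its Pfaffian, and the
vanishing of the Pfaffian is the three-term relation. -/

lemma norm_nome_lt_one {τ : ℂ} (hτ : 0 < τ.im) :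
    ‖Complex.exp (2 * Real.pi * Complex.I * τ)‖ < 1 := by
  rw [Complex.norm_exp]
  simp only [Real.exp_lt_one_iff]
  have := mul_pos Real.pi_pos hτ
  simp
  linarith

lemma multipliable_one_sub_pow_mul {q : ℂ} (hq : ‖q‖ < 1) (x : ℂ) :
    Multipliable fun s : ℕ => 1 - q ^ s * x := by
  simp_rw [sub_eq_add_neg]
  apply multipliable_one_add_of_summable
  simpa using (summable_geometric_of_lt_one (norm_nonneg _) hq).mul_right ‖x‖

lemma eulerProd_eq_mul {τ : ℂ} (hτ : 0 < τ.im) (x : ℂ) :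
    eulerProd τ x =
      (1 - x) * eulerProd τ (Complex.exp (2 * Real.pi * Complex.I * τ) * x) := by
  have hq := norm_nome_lt_one hτ
  unfold eulerProd
  generalize Complex.exp (2 * Real.pi * Complex.I * τ) = q at hq ⊢
  have h : Multipliable fun s : ℕ => 1 - q ^ (s + 1) * x := by
    refine (multipliable_one_sub_pow_mul hq (q * x)).congr fun s => ?_
    rw [pow_succ, mul_assoc]
  have h' := tprod_eq_zero_mul' (f := fun s : ℕ => 1 - q ^ s * x) h
  rw [h']
  simp only [pow_zero, one_mul, pow_succ, mul_assoc]

lemma differentiable_eulerProd {τ : ℂ} (hτ : 0 < τ.im) : Differentiable ℂ (eulerProd τ) := by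
  have hq := norm_nome_lt_one hτ
  unfold eulerProd
  set q := Complex.exp (2 * Real.pi * Complex.I * τ)
  have h : HasProdLocallyUniformlyOn (fun (s : ℕ) (x : ℂ) => 1 - q ^ s * x)
      (fun x => ∏' s : ℕ, (1 - q ^ s * x)) Set.univ := by
    simp_rw [sub_eq_add_neg]
    apply hasProdLocallyUniformlyOn_of_forall_compact isOpen_univ
    intro K _ hcK
    obtain ⟨R, hR⟩ := hcK.isBounded.exists_norm_le
    refine ((summable_geometric_of_lt_one (norm_nonneg _) hq).mul_right R).hasProdUniformlyOn_nat_one_add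
      hcK (.of_forall fun n x hx ↦ ?_) (fun _ ↦ by fun_prop)
    simpa using mul_le_mul_of_nonneg_left (hR x hx) (pow_nonneg (norm_nonneg q) n)
  rw [← differentiableOn_univ]
  exact h.differentiableOn (.of_forall fun _ ↦ by
    simpa [Finset.prod_fn] using DifferentiableOn.finsetProd (fun _ _ ↦ by fun_prop)) isOpen_univ

lemma differentiable_theta {τ : ℂ} (hτ : 0 < τ.im) : Differentiable ℂ (theta τ) := by
  have h := differentiable_eulerProd hτ
  have h1 : Differentiable ℂ fun u : ℂ => eulerProd τ (Complex.exp (2 * Real.pi * Complex.I * τ) *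
        Complex.exp (2 * Real.pi * Complex.I * u)) := h.comp (by fun_prop)
  have h2 : Differentiable ℂ fun u : ℂ => eulerProd τ (Complex.exp (2 * Real.pi * Complex.I * τ) /
        Complex.exp (2 * Real.pi * Complex.I * u)) := h.comp (by
          simp_rw [div_eq_mul_inv, ← Complex.exp_neg]; fun_prop)
  unfold theta
  exact (Differentiable.mul (by fun_prop) h1).mul h2

lemma theta_neg (τ u : ℂ) : theta τ (-u) = -theta τ u := by
  unfold theta
  have h : Complex.exp (2 * Real.pi * Complex.I * -u) =
      (Complex.exp (2 * Real.pi * Complex.I * u))⁻¹ := by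
    rw [← Complex.exp_neg]; ring_nf
  rw [h, div_inv_eq_mul, ← div_eq_mul_inv]
  ring_nf

lemma theta_add_one (τ u : ℂ) : theta τ (u + 1) = -theta τ u := by
  unfold theta
  have h : Complex.exp (2 * Real.pi * Complex.I * (u + 1)) =
      Complex.exp (2 * Real.pi * Complex.I * u) := by
    rw [mul_add, mul_one, Complex.exp_add, Complex.exp_two_pi_mul_I, mul_one]
  have h1 : Complex.exp (Real.pi * Complex.I * (u + 1)) =
      -Complex.exp (Real.pi * Complex.I * u) := by
    rw [mul_add, mul_one, Complex.exp_add, Complex.exp_pi_mul_I]; ring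
  rw [h, Complex.exp_neg, h1, Complex.exp_neg, inv_neg]
  ring

lemma theta_add_tau {τ : ℂ} (hτ : 0 < τ.im) (u : ℂ) :
    theta τ (u + τ) = -Complex.exp (-(Real.pi * Complex.I * (2 * u + τ))) * theta τ u := by
  unfold theta
  set e := Complex.exp (Real.pi * Complex.I * u) with he
  set r := Complex.exp (Real.pi * Complex.I * τ) with hr
  have he0 : e ≠ 0 := Complex.exp_ne_zero _
  have hr0 : r ≠ 0 := Complex.exp_ne_zero _
  have hq : Complex.exp (2 * Real.pi * Complex.I * τ) = r ^ 2 := by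
    rw [hr, ← Complex.exp_nat_mul]; push_cast; ring_nf
  have hx : Complex.exp (2 * Real.pi * Complex.I * u) = e ^ 2 := by
    rw [he, ← Complex.exp_nat_mul]; push_cast; ring_nf
  have h1 : Complex.exp (2 * Real.pi * Complex.I * (u + τ)) = e ^ 2 * r ^ 2 := by
    rw [mul_add, Complex.exp_add, hq, hx]
  have h2 : Complex.exp (Real.pi * Complex.I * (u + τ)) = e * r := by
    rw [mul_add, Complex.exp_add]
  have h3 : Complex.exp (-(Real.pi * Complex.I * (2 * u + τ))) = (e ^ 2 * r)⁻¹ := by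
    rw [Complex.exp_neg, ← hx, hr, ← Complex.exp_add]; ring_nf
  have hE := eulerProd_eq_mul hτ (r ^ 2 * e ^ 2)
  have hE' := eulerProd_eq_mul hτ (r ^ 2 / (e ^ 2 * r ^ 2))
  rw [hq] at hE hE'
  rw [h3, Complex.exp_neg, Complex.exp_neg, h2, h1, hq, hx, mul_comm (e ^ 2) (r ^ 2), hE,
    mul_comm (r ^ 2) (e ^ 2), hE']
  have h4 : r ^ 2 * (r ^ 2 / (e ^ 2 * r ^ 2)) = r ^ 2 / e ^ 2 := by field_simp
  rw [h4]
  field_simp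
  ring

/-! ### Second order theta functions and the three-term relation -/

/-- Cauchy's theorem on the rectangle with corners 0 and 1 + i Im w: the vertical sides cancel by
periodicity. The remaining real translation is absorbed by periodicity as well. -/
lemma intervalIntegral_add_eq_of_periodic {G : ℂ → ℂ} (hG : Differentiable ℂ G)
    (h1 : ∀ x, G (x + 1) = G x) (w : ℂ) :
    ∫ x : ℝ in (0 : ℝ)..1, G (x + w) = ∫ x : ℝ in (0 : ℝ)..1, G x := by
  have hr := Complex.integral_boundary_rect_eq_zero_of_differentiableOn G 0
    (1 + w.im * Complex.I) hG.differentiableOn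
  have hs : ∀ y : ℝ, G (1 + y * Complex.I) = G (y * Complex.I) := fun y => by
    rw [add_comm, h1]
  simp [hs] at hr
  rw [sub_eq_zero.1 hr]
  have hp : Function.Periodic (fun x : ℝ => G (x + w.im * Complex.I)) 1 := fun x => by
    simp only [Complex.ofReal_add, Complex.ofReal_one]
    rw [add_right_comm, h1]
  have := hp.intervalIntegral_add_eq w.re 0
  rw [zero_add] at this
  have ht := intervalIntegral.integral_comp_add_right (a := 0) (b := 1)
    (fun x : ℝ => G (x + w.im * Complex.I)) w.re
  rw [zero_add, add_comm 1] at ht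
  rw [← this, ← ht]
  refine intervalIntegral.integral_congr fun x _ => ?_
  simp only [Complex.ofReal_add, add_assoc, Complex.re_add_im]

/-- The `n`-th Fourier coefficient of a function of period `1`. -/
noncomputable def fourierIntegral (F : ℂ → ℂ) (n : ℤ) : ℂ :=
  ∫ x : ℝ in (0 : ℝ)..1, F x * Complex.exp (-(2 * Real.pi * Complex.I * n * x))

/-- Second order theta functions: the factor of automorphy of
`x ↦ theta τ (x + y) * theta τ (x - y)`. -/
structure IsSecondOrder (τ : ℂ) (F : ℂ → ℂ) : Prop where
  differentiable : Differentiable ℂ F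
  add_one : ∀ x, F (x + 1) = F x
  add_tau : ∀ x, F (x + τ) = Complex.exp (-(2 * Real.pi * Complex.I * (2 * x + τ))) * F x

lemma isSecondOrder_theta_mul_theta {τ : ℂ} (hτ : 0 < τ.im) (y : ℂ) :
    IsSecondOrder τ fun x => theta τ (x + y) * theta τ (x - y) where
  differentiable := by
    have := differentiable_theta hτ
    fun_prop
  add_one x := by
    rw [add_right_comm, add_sub_right_comm, theta_add_one, theta_add_one]; ring
  add_tau x := by
    rw [add_right_comm, add_sub_right_comm, theta_add_tau hτ, theta_add_tau hτ,
      show -(2 * Real.pi * Complex.I * (2 * x + τ)) =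
        -(Real.pi * Complex.I * (2 * (x + y) + τ)) + -(Real.pi * Complex.I * (2 * (x - y) + τ))
        by ring, Complex.exp_add]
    ring

lemma exp_int_mul_add_one (n : ℤ) (x : ℂ) :
    Complex.exp (-(2 * Real.pi * Complex.I * n * (x + 1))) =
      Complex.exp (-(2 * Real.pi * Complex.I * n * x)) := by
  rw [show -(2 * Real.pi * Complex.I * n * (x + 1)) =
    -(2 * Real.pi * Complex.I * n * x) + (-n : ℤ) * (2 * Real.pi * Complex.I) by push_cast; ring,
    Complex.exp_add, Complex.exp_int_mul_two_pi_mul_I, mul_one]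

/-- Moving the contour by τ multiplies the integrand by the factor of automorphy, which raises the
Fourier index by two. Hence the coefficients of index 0 and 1 determine all others. -/
lemma IsSecondOrder.fourierIntegral_add_two {τ : ℂ} {F : ℂ → ℂ} (hF : IsSecondOrder τ F)
    (n : ℤ) : fourierIntegral F (n + 2) =
      Complex.exp (2 * Real.pi * Complex.I * (n + 1) * τ) * fourierIntegral F n := by
  have hd := hF.differentiable
  have h := intervalIntegral_add_eq_of_periodic
    (G := fun x => F x * Complex.exp (-(2 * Real.pi * Complex.I * n * x))) (by fun_prop)
    (fun x => by rw [hF.add_one, exp_int_mul_add_one]) τ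
  unfold fourierIntegral
  rw [← h, ← intervalIntegral.integral_const_mul]
  refine intervalIntegral.integral_congr fun x _ => ?_
  simp only [hF.add_tau]
  rw [mul_comm (Complex.exp _) (F x), mul_assoc (F x), mul_left_comm _ (F x),
    ← Complex.exp_add, ← Complex.exp_add]
  congr 2
  push_cast
  ring

lemma IsSecondOrder.fourierIntegral_eq_zero {τ : ℂ} {F : ℂ → ℂ} (hF : IsSecondOrder τ F)
    (h0 : fourierIntegral F 0 = 0) (h1 : fourierIntegral F 1 = 0) (n : ℤ) :
    fourierIntegral F n = 0 := by
  have key : ∀ n, fourierIntegral F n = 0 ↔ fourierIntegral F (n + 2) = 0 := fun n => by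
    rw [hF.fourierIntegral_add_two]
    simp [Complex.exp_ne_zero]
  have h : ∀ n : ℤ, fourierIntegral F n = 0 ∧ fourierIntegral F (n + 1) = 0 := by
    intro n
    induction n using Int.induction_on with
    | zero => exact ⟨h0, by simpa using h1⟩
    | succ k ih => exact ⟨ih.2, by rw [add_assoc]; exact (key _).1 ih.1⟩
    | pred k ih =>
      refine ⟨(key _).2 ?_, by simpa using ih.1⟩
      rw [show -(k : ℤ) - 1 + 2 = -k + 1 by ring]
      exact ih.2
  exact (h n).1

/-- The Fourier series, being zero, converges pointwise to F on the real line; the identity theorem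
extends the vanishing to the plane. -/
lemma eq_zero_of_fourierIntegral_eq_zero {F : ℂ → ℂ} (hd : Differentiable ℂ F)
    (h1 : ∀ x, F (x + 1) = F x) (h : ∀ n, fourierIntegral F n = 0) (x : ℂ) : F x = 0 := by
  have : Fact ((0 : ℝ) < 1) := ⟨one_pos⟩
  have hp : Function.Periodic (fun x : ℝ => F x) 1 := fun x => by
    simp only [Complex.ofReal_add, Complex.ofReal_one, h1]
  have hc : Continuous (fun x : ℝ => F x) := hd.continuous.comp Complex.continuous_ofReal
  let f : C(AddCircle (1 : ℝ), ℂ) := ⟨hp.lift, continuous_coinduced_dom.mpr hc⟩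
  have hf : ∀ x : ℝ, f (x : AddCircle (1 : ℝ)) = F x := fun x => hp.lift_coe x
  have hcoeff : ∀ n, fourierCoeff f n = 0 := fun n => by
    rw [fourierCoeff_eq_intervalIntegral f n 0, ← (h n)]
    simp only [fourierIntegral, fourier_coe_apply, hf, zero_add, div_one, one_smul, smul_eq_mul,
      Complex.ofReal_one]
    refine intervalIntegral.integral_congr fun x _ => ?_
    rw [mul_comm]
    congr 2
    push_cast
    ring
  have hz : ∀ x : ℝ, F x = 0 := fun x => by
    have hs := has_pointwise_sum_fourier_series_of_summable (f := f)
      (by rw [show fourierCoeff f = 0 from funext hcoeff]; exact summable_zero) x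
    simp only [hcoeff, zero_smul] at hs
    rw [← hf]
    exact hs.unique hasSum_zero
  have ha : AnalyticOnNhd ℂ F Set.univ := fun z _ => hd.analyticAt z
  refine ha.eqOn_zero_of_preconnected_of_frequently_eq_zero isPreconnected_univ (Set.mem_univ 0)
    ?_ (Set.mem_univ x)
  -- The real points 1/(k + 1) are zeros accumulating at 0.
  have ht : Filter.Tendsto (fun k : ℕ => ((1 / ((k : ℝ) + 1) : ℝ) : ℂ)) Filter.atTop
      (nhdsWithin 0 {0}ᶜ) := by
    rw [tendsto_nhdsWithin_iff]
    refine ⟨?_, Filter.Eventually.of_forall fun k => ?_⟩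
    · have := (Complex.continuous_ofReal.tendsto 0).comp (tendsto_one_div_add_atTop_nhds_zero_nat (𝕜 := ℝ))
      exact this
    · simp only [Set.mem_compl_iff, Set.mem_singleton_iff, Complex.ofReal_eq_zero]
      positivity
  exact ht.frequently (Filter.Frequently.of_forall fun k => hz _)

/-- Column j consists of values at the points p i of the second order function with parameter p j,
and four such functions are linearly dependent. -/
lemma det_theta_mul_theta {τ : ℂ} (hτ : 0 < τ.im) (p : Fin 4 → ℂ) :
    (Matrix.of fun i j => theta τ (p i + p j) * theta τ (p i - p j)).det = 0 := by
  -- The rows 0 and 1 hold the two determining Fourier coefficients of the four functions; the zero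
  -- rows only make the matrix square, so that a kernel vector gives the dependency.
  let C : Matrix (Fin 4) (Fin 4) ℂ := Matrix.of fun i j =>
    if i = 0 then fourierIntegral (fun x => theta τ (x + p j) * theta τ (x - p j)) 0
    else if i = 1 then fourierIntegral (fun x => theta τ (x + p j) * theta τ (x - p j)) 1
    else 0
  have hC : C.det = 0 := Matrix.det_eq_zero_of_row_eq_zero 2 fun j => by simp [C]
  obtain ⟨v, hv, hCv⟩ := Matrix.exists_mulVec_eq_zero_iff.2 hC
  refine Matrix.exists_mulVec_eq_zero_iff.1 ⟨v, hv, ?_⟩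
  have hs := fun j => isSecondOrder_theta_mul_theta hτ (p j)
  set F : ℂ → ℂ := fun x => ∑ j, v j * (theta τ (x + p j) * theta τ (x - p j)) with hFdef
  have hF : IsSecondOrder τ F :=
    { differentiable := by
        refine Differentiable.fun_sum fun j _ => ?_
        exact (hs j).differentiable.const_mul _
      add_one := fun x => Finset.sum_congr rfl fun j _ => by rw [(hs j).add_one]
      add_tau := fun x => by
        simp only [hFdef]
        rw [Finset.mul_sum]
        refine Finset.sum_congr rfl fun j _ => ?_
        rw [(hs j).add_tau]
        ring }
  have hlin : ∀ n, fourierIntegral F n =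
      ∑ j, fourierIntegral (fun x => theta τ (x + p j) * theta τ (x - p j)) n * v j := fun n => by
    unfold fourierIntegral
    simp only [hFdef, Finset.sum_mul]
    rw [intervalIntegral.integral_finsetSum]
    · refine Finset.sum_congr rfl fun j _ => ?_
      rw [← intervalIntegral.integral_mul_const]
      refine intervalIntegral.integral_congr fun x _ => ?_
      ring
    · intro j _
      apply Continuous.intervalIntegrable
      have := (hs j).differentiable.continuous
      have h2 : Continuous fun x : ℝ => theta τ (x + p j) * theta τ (x - p j) :=
        this.comp Complex.continuous_ofReal
      fun_prop
  have h0 := congrFun hCv 0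
  have h1 := congrFun hCv 1
  simp only [Matrix.mulVec, dotProduct, C, Matrix.of_apply, if_true, Pi.zero_apply,
    if_neg (show ¬(1 : Fin 4) = 0 by decide)] at h0 h1
  have hz := eq_zero_of_fourierIntegral_eq_zero hF.differentiable hF.add_one
    (hF.fourierIntegral_eq_zero (by rw [hlin, h0]) (by rw [hlin, h1]))
  ext i
  have := hz (p i)
  simp only [hFdef] at this
  simp only [Matrix.mulVec, dotProduct, Matrix.of_apply, Pi.zero_apply]
  rw [← this]
  exact Finset.sum_congr rfl fun j _ => mul_comm _ _

/-- The right-hand side is the square of the Pfaffian. The vanishing of the diagonal is a separate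
hypothesis because 2 may be a zero divisor in the ring. -/
lemma det_antisymm_fin_four {R : Type*} [CommRing R] (A : Matrix (Fin 4) (Fin 4) R)
    (h0 : ∀ i, A i i = 0) (h : ∀ i j, A j i = -A i j) :
    A.det = (A 0 1 * A 2 3 - A 0 2 * A 1 3 + A 0 3 * A 1 2) ^ 2 := by
  simp [Matrix.det_succ_row_zero, Fin.sum_univ_succ, Fin.succAbove, h0, h 0 1, h 0 2, h 0 3, h 1 2,
    h 1 3, h 2 3]
  ring

/-- The three-term (Weierstrass) relation. -/
theorem theta_three_term {τ : ℂ} (hτ : 0 < τ.im) (x y z w : ℂ) :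
    theta τ (x + y) * theta τ (x - y) * (theta τ (z + w) * theta τ (z - w))
      + theta τ (x + z) * theta τ (x - z) * (theta τ (w + y) * theta τ (w - y))
      + theta τ (x + w) * theta τ (x - w) * (theta τ (y + z) * theta τ (y - z)) = 0 := by
  have hdet := det_theta_mul_theta hτ ![x, y, z, w]
  have h0 : theta τ 0 = 0 := by simp [theta]
  have hanti : ∀ a b : ℂ, theta τ (b + a) * theta τ (b - a) =
      -(theta τ (a + b) * theta τ (a - b)) := fun a b => by
    rw [add_comm, ← neg_sub a b, theta_neg]; ring
  rw [det_antisymm_fin_four _ (by intro i; simp [h0]) (by intro i j; exact hanti _ _)] at hdet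
  have h := pow_eq_zero_iff two_ne_zero |>.1 hdet
  simp only [Matrix.of_apply, Matrix.cons_val] at h
  rw [hanti y w]
  linear_combination h

/-! ### Consequences of the three-term relation -/

/-- An odd function that satisfies the three-term relation of the theta function. -/
structure IsThetaLike (f : ℂ → ℂ) : Prop where
  neg : ∀ x, f (-x) = -f x
  three_term : ∀ x y z w, f (x + y) * f (x - y) * (f (z + w) * f (z - w))
      + f (x + z) * f (x - z) * (f (w + y) * f (w - y))
      + f (x + w) * f (x - w) * (f (y + z) * f (y - z)) = 0

lemma isThetaLike_theta {τ : ℂ} (hτ : 0 < τ.im) : IsThetaLike (theta τ) :=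
  ⟨theta_neg τ, theta_three_term hτ⟩

namespace IsThetaLike

variable {f : ℂ → ℂ}

/-- The three-term relation for three pairs of arguments with the same sum. -/
lemma pairs (hf : IsThetaLike f) (a a' b b' c c' : ℂ) (h₁ : a + a' = b + b')
    (h₂ : a + a' = c + c') :
    f a * f a' * (f (b - c) * f (b - c')) + f b * f b' * (f (c - a) * f (c - a')) +
      f c * f c' * (f (a - b) * f (a - b')) = 0 := by
  have h := hf.three_term ((a + a') / 2) ((a - a') / 2) ((b - b') / 2) ((c - c') / 2)
  rw [show (a + a') / 2 + (a - a') / 2 = a by ring, show (a + a') / 2 - (a - a') / 2 = a' by ring,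
    show (a + a') / 2 + (b - b') / 2 = b by linear_combination h₁ / 2,
    show (a + a') / 2 - (b - b') / 2 = b' by linear_combination h₁ / 2,
    show (a + a') / 2 + (c - c') / 2 = c by linear_combination h₂ / 2,
    show (a + a') / 2 - (c - c') / 2 = c' by linear_combination h₂ / 2,
    show (b - b') / 2 + (c - c') / 2 = b - c' by linear_combination (h₁ - h₂) / 2,
    show (b - b') / 2 - (c - c') / 2 = b - c by linear_combination (h₁ - h₂) / 2,
    show (c - c') / 2 + (a - a') / 2 = -(c' - a) by linear_combination -h₂ / 2,
    show (c - c') / 2 - (a - a') / 2 = c - a by linear_combination h₂ / 2,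
    show (a - a') / 2 + (b - b') / 2 = a - b' by linear_combination -h₁ / 2,
    show (a - a') / 2 - (b - b') / 2 = a - b by linear_combination -h₁ / 2] at h
  have h3 : f (c - a') = f (a - c') := by
    congr 1; linear_combination -h₂
  have h4 : f (c' - a) = -f (a - c') := by
    rw [← hf.neg]; congr 1; ring
  rw [hf.neg, h4] at h
  rw [h3]
  linear_combination h

/-- The sum over the exchange of `s₁` and `s₂` that adds two elements of the same colour to a
level is symmetric in the variables of the next level. -/
lemma exchange_same (hf : IsThetaLike f) (η d d' s s2 u u2 : ℂ) (hd : d' = d + η)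
    (h0 : f d ≠ 0) (h1 : f d' ≠ 0) (hs : f (s2 - s) ≠ 0) :
    f (u - s + d) / f d * f (u2 - s) * f (η + (u - s2)) * (f (u2 - s2 + d') / f d') *
        (f (η + s2 - s) / f (s2 - s)) +
      f (u - s2 + d) / f d * f (u2 - s2) * f (η + (u - s)) * (f (u2 - s + d') / f d') *
        (f (η + s - s2) / f (s - s2)) =
    f (u2 - s + d) / f d * f (u - s) * f (η + (u2 - s2)) * (f (u - s2 + d') / f d') *
        (f (η + s2 - s) / f (s2 - s)) +
      f (u2 - s2 + d) / f d * f (u - s2) * f (η + (u2 - s)) * (f (u - s + d') / f d') *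
        (f (η + s - s2) / f (s - s2)) := by
  subst hd
  have hs' : f (s - s2) = -f (s2 - s) := by rw [← hf.neg]; congr 1; ring
  -- For fixed argument sum, these products of two values of f span a space of dimension at most
  -- two. `i1` and `i2` rewrite the u-products of the left side, and `e1` and `e2` the u2-products
  -- of the right side, in terms of the products with shift d + η that occur on the opposite side.
  -- Both sides then become the same bilinear expression.
  have i1 : (f (u - s + d) * f (η + (u - s2)) * f (s2 - s) * f (d + η))
      + f (u - s2) * f (u - s + (d + η)) * f d * f (η + s - s2)
      - f (u - s) * f (u - s2 + (d + η)) * f (s2 - s + d) * f η = 0 := by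
    have h := hf.pairs (u - s + d) (η + (u - s2)) (u - s2) (u - s + (d + η)) (u - s) (u - s2 + (d + η)) (by ring) (by ring)
    rw [show (u - s2) - (u - s) = -(s2 - s) by ring,
      show (u - s2) - (u - s2 + (d + η)) = -(d + η) by ring,
      show (u - s) - (u - s + d) = -(d) by ring,
      show (u - s) - (η + (u - s2)) = -(η + s - s2) by ring,
      show (u - s + d) - (u - s2) = s2 - s + d by ring,
      show (u - s + d) - (u - s + (d + η)) = -(η) by ring] at h
    simp only [hf.neg] at h
    linear_combination h
  have i2 : (f (u - s2 + d) * f (η + (u - s)) * f (s2 - s) * f (d + η))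
      + f (u - s2) * f (u - s + (d + η)) * f (s - s2 + d) * f η
      - f (u - s) * f (u - s2 + (d + η)) * f d * f (η + s2 - s) = 0 := by
    have h := hf.pairs (u - s2 + d) (η + (u - s)) (u - s2) (u - s + (d + η)) (u - s) (u - s2 + (d + η)) (by ring) (by ring)
    rw [show (u - s2) - (u - s) = -(s2 - s) by ring,
      show (u - s2) - (u - s2 + (d + η)) = -(d + η) by ring,
      show (u - s) - (u - s2 + d) = -(s - s2 + d) by ring,
      show (u - s) - (η + (u - s)) = -(η) by ring,
      show (u - s2 + d) - (u - s2) = d by ring,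
      show (u - s2 + d) - (u - s + (d + η)) = -(η + s2 - s) by ring] at h
    simp only [hf.neg] at h
    linear_combination h
  have e1 : (f (u2 - s) * f (u2 - s2 + (d + η)) * f d * f (η + s2 - s))
      - f (s - s2 + d) * f η * f (u2 - s2) * f (u2 - s + (d + η))
      - f (s2 - s) * f (u2 - s2 + d) * f (η + (u2 - s)) * f (d + η) = 0 := by
    have h := hf.pairs (u2 - s) (u2 - s2 + (d + η)) (u2 - s2) (u2 - s + (d + η)) (u2 - s2 + d) (η + (u2 - s)) (by ring) (by ring)
    rw [show (u2 - s2) - (u2 - s2 + d) = -(d) by ring,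
      show (u2 - s2) - (η + (u2 - s)) = -(η + s2 - s) by ring,
      show (u2 - s2 + d) - (u2 - s) = s - s2 + d by ring,
      show (u2 - s2 + d) - (u2 - s2 + (d + η)) = -(η) by ring,
      show (u2 - s) - (u2 - s2) = s2 - s by ring,
      show (u2 - s) - (u2 - s + (d + η)) = -(d + η) by ring] at h
    simp only [hf.neg] at h
    linear_combination h
  have e2 : (f (u2 - s2) * f (u2 - s + (d + η)) * f d * f (η + s - s2))
      - f (s2 - s + d) * f η * f (u2 - s) * f (u2 - s2 + (d + η))
      + f (s2 - s) * f (u2 - s + d) * f (η + (u2 - s2)) * f (d + η) = 0 := by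
    have h := hf.pairs (u2 - s2) (u2 - s + (d + η)) (u2 - s) (u2 - s2 + (d + η)) (u2 - s + d) (η + (u2 - s2)) (by ring) (by ring)
    rw [show (u2 - s) - (u2 - s + d) = -(d) by ring,
      show (u2 - s) - (η + (u2 - s2)) = -(η + s - s2) by ring,
      show (u2 - s + d) - (u2 - s2) = s2 - s + d by ring,
      show (u2 - s + d) - (u2 - s + (d + η)) = -(η) by ring,
      show (u2 - s2) - (u2 - s) = -(s2 - s) by ring,
      show (u2 - s2) - (u2 - s2 + (d + η)) = -(d + η) by ring] at h
    simp only [hf.neg] at h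
    linear_combination h
  have key : f (u - s + d) * f (u2 - s) * f (η + (u - s2)) * f (u2 - s2 + (d + η)) * f (η + s2 - s)
      - f (u - s2 + d) * f (u2 - s2) * f (η + (u - s)) * f (u2 - s + (d + η)) * f (η + s - s2)
      - f (u2 - s + d) * f (u - s) * f (η + (u2 - s2)) * f (u - s2 + (d + η)) * f (η + s2 - s)
      + f (u2 - s2 + d) * f (u - s2) * f (η + (u2 - s)) * f (u - s + (d + η)) * f (η + s - s2)
      = 0 := by
    refine (mul_eq_zero.1 ?_).resolve_left (mul_ne_zero hs h1)
    linear_combination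
      f (u2 - s) * f (u2 - s2 + (d + η)) * f (η + s2 - s) * i1 -
      f (u2 - s2) * f (u2 - s + (d + η)) * f (η + s - s2) * i2 -
      f (u - s2) * f (u - s + (d + η)) * f (η + s - s2) * e1 -
      f (u - s) * f (u - s2 + (d + η)) * f (η + s2 - s) * e2
  rw [hs']
  field_simp
  linear_combination key

/-- The intertwining relation of the dynamical `R`-matrix passes from a level, where it relates
`A`, `B` and their images `A'`, `B'` under the exchange of the variables, to the next level. -/
lemma exchange_step (hf : IsThetaLike f) {η δ e e' x0 x1 u v A A' B B' : ℂ} (y0 y1 : ℂ)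
    (he : e' = e + δ) (h0 : f e ≠ 0) (h1 : f e' ≠ 0) (hx : f (x1 - x0) ≠ 0) (hδ : f δ ≠ 0)
    (huv : u * v * f δ ^ 2 = -(f (η + δ) * f (η - δ)))
    (hA : f (η + x0 - x1) * A' * f δ =
      u * f (x0 - x1) * B * f δ + f (x0 - x1 + δ) * f η * A)
    (hB : f (η + x0 - x1) * B' * f δ =
      v * f (x0 - x1) * A * f δ - f (x0 - x1 - δ) * f η * B) :
    f (η + y0 - y1) *
        (f (y1 - x0 + e) / f e * f (y0 - x0) * f (η + (y1 - x1)) * (f (y0 - x1 + e') / f e') *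
            (f (η + x1 - x0) / f (x1 - x0)) * A +
          f (y1 - x1 + e) / f e * f (y0 - x1) * f (η + (y1 - x0)) * (f (y0 - x0 + e') / f e') *
            (f (η + x0 - x1) / f (x0 - x1)) * A') * f δ =
      u * f (y0 - y1) *
        (f (y0 - x0 + e') / f e' * f (y1 - x0) * f (η + (y0 - x1)) * (f (y1 - x1 + e) / f e) *
            (f (η + x1 - x0) / f (x1 - x0)) * B +
          f (y0 - x1 + e') / f e' * f (y1 - x1) * f (η + (y0 - x0)) * (f (y1 - x0 + e) / f e) *
            (f (η + x0 - x1) / f (x0 - x1)) * B') * f δ +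
      f (y0 - y1 + δ) * f η *
        (f (y0 - x0 + e) / f e * f (y1 - x0) * f (η + (y0 - x1)) * (f (y1 - x1 + e') / f e') *
            (f (η + x1 - x0) / f (x1 - x0)) * A +
          f (y0 - x1 + e) / f e * f (y1 - x1) * f (η + (y0 - x0)) * (f (y1 - x0 + e') / f e') *
            (f (η + x0 - x1) / f (x0 - x1)) * A') := by
  subst he
  have hx' : f (x1 - x0) = -f (x0 - x1) := by rw [← hf.neg]; congr 1; ring
  have hx0 : f (x0 - x1) ≠ 0 := fun h => hx (by rw [hx', h, neg_zero])
  -- The four products containing e have equal argument sums; `r123` and `r124` express the last two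
  -- through the first two. Below, `t1` and `t2` play the same role for the four products free of e.
  have r123 : (f (y1 - x1 + e) * f (y0 - x0 + (e + δ)) * f δ * f (x0 - x1 + (y0 - y1)))
      + f (y0 - x1 + (e + δ)) * f (y1 - x0 + e) * f (y0 - y1) * f (x0 - x1 - δ)
      - f (y0 - x1 + e) * f (y1 - x0 + (e + δ)) * f (y0 - y1 + δ) * f (x0 - x1) = 0 := by
    have h := hf.pairs (y1 - x1 + e) (y0 - x0 + (e + δ)) (y0 - x1 + (e + δ)) (y1 - x0 + e) (y0 - x1 + e) (y1 - x0 + (e + δ)) (by ring) (by ring)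
    rw [show (y0 - x1 + (e + δ)) - (y0 - x1 + e) = δ by ring,
      show (y0 - x1 + (e + δ)) - (y1 - x0 + (e + δ)) = x0 - x1 + (y0 - y1) by ring,
      show (y0 - x1 + e) - (y1 - x1 + e) = y0 - y1 by ring,
      show (y0 - x1 + e) - (y0 - x0 + (e + δ)) = x0 - x1 - δ by ring,
      show (y1 - x1 + e) - (y0 - x1 + (e + δ)) = -(y0 - y1 + δ) by ring,
      show (y1 - x1 + e) - (y1 - x0 + e) = x0 - x1 by ring] at h
    simp only [hf.neg] at h
    linear_combination h
  have r124 : (f (y1 - x1 + e) * f (y0 - x0 + (e + δ)) * f (y0 - y1) * f (x0 - x1 + δ))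
      + f (y0 - x1 + (e + δ)) * f (y1 - x0 + e) * f δ * f (x0 - x1 - (y0 - y1))
      - f (y0 - x0 + e) * f (y1 - x1 + (e + δ)) * f (x0 - x1) * f (y0 - y1 + δ) = 0 := by
    have h := hf.pairs (y1 - x1 + e) (y0 - x0 + (e + δ)) (y0 - x1 + (e + δ)) (y1 - x0 + e) (y0 - x0 + e) (y1 - x1 + (e + δ)) (by ring) (by ring)
    rw [show (y0 - x1 + (e + δ)) - (y0 - x0 + e) = x0 - x1 + δ by ring,
      show (y0 - x1 + (e + δ)) - (y1 - x1 + (e + δ)) = y0 - y1 by ring,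
      show (y0 - x0 + e) - (y1 - x1 + e) = -(x0 - x1 - (y0 - y1)) by ring,
      show (y0 - x0 + e) - (y0 - x0 + (e + δ)) = -(δ) by ring,
      show (y1 - x1 + e) - (y0 - x1 + (e + δ)) = -(y0 - y1 + δ) by ring,
      show (y1 - x1 + e) - (y1 - x0 + e) = x0 - x1 by ring] at h
    simp only [hf.neg] at h
    linear_combination h
  have t1 : (f (x0 - x1) * f (η + y0 - y1) * f (y0 - x1) * f (η + (y1 - x0)))
      + f (y0 - y1) * f (y1 - x0) * f (η + (y0 - x1)) * f (η + x1 - x0)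
      - f η * f (x0 - x1 + (y0 - y1)) * f (y1 - x1) * f (η + (y0 - x0)) = 0 := by
    have h := hf.pairs (x0 - x1) (η + y0 - y1) (-(y1 - x0)) (η + (y0 - x1)) η (x0 - x1 + (y0 - y1)) (by ring) (by ring)
    rw [show (-(y1 - x0)) - η = -(η + (y1 - x0)) by ring,
      show (-(y1 - x0)) - (x0 - x1 + (y0 - y1)) = -(y0 - x1) by ring,
      show η - (x0 - x1) = η + x1 - x0 by ring,
      show η - (η + y0 - y1) = -(y0 - y1) by ring,
      show (x0 - x1) - (-(y1 - x0)) = y1 - x1 by ring,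
      show (x0 - x1) - (η + (y0 - x1)) = -(η + (y0 - x0)) by ring] at h
    simp only [hf.neg] at h
    linear_combination h
  have t2 : (f (x0 - x1) * f (η + y0 - y1) * f (y0 - x0) * f (η + (y1 - x1)))
      - f η * f (x0 - x1 - (y0 - y1)) * f (y1 - x0) * f (η + (y0 - x1))
      - f (y0 - y1) * f (η + x0 - x1) * f (y1 - x1) * f (η + (y0 - x0)) = 0 := by
    have h := hf.pairs (x0 - x1) (η + y0 - y1) (-(y1 - x0)) (η + (y0 - x1)) (y0 - y1) (η + x0 - x1) (by ring) (by ring)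
    rw [show (-(y1 - x0)) - (y0 - y1) = -(y0 - x0) by ring,
      show (-(y1 - x0)) - (η + x0 - x1) = -(η + (y1 - x1)) by ring,
      show (y0 - y1) - (x0 - x1) = -(x0 - x1 - (y0 - y1)) by ring,
      show (y0 - y1) - (η + y0 - y1) = -(η) by ring,
      show (x0 - x1) - (-(y1 - x0)) = y1 - x1 by ring,
      show (x0 - x1) - (η + (y0 - x1)) = -(η + (y0 - x0)) by ring] at h
    simp only [hf.neg] at h
    linear_combination h
  -- Together with `huv` this is a diagonal entry of the unitarity relation of the R-matrix; only
  -- the product u * v enters, not u and v separately.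
  have t0 : -(f (x0 - x1) * f (x0 - x1) * f (η + δ) * f (η - δ))
      + f η * f η * f (x0 - x1 + δ) * f (x0 - x1 - δ)
      + f δ * f δ * f (η + x0 - x1) * f (η + x1 - x0) = 0 := by
    have h := hf.pairs (x0 - x1) (x0 - x1) (x0 - x1 + δ) (x0 - x1 - δ) (η + x0 - x1) (-(η + x1 - x0)) (by ring) (by ring)
    rw [show (x0 - x1 + δ) - (η + x0 - x1) = -(η - δ) by ring,
      show (x0 - x1 + δ) - (-(η + x1 - x0)) = η + δ by ring,
      show (η + x0 - x1) - (x0 - x1) = η by ring,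
      show (x0 - x1) - (x0 - x1 + δ) = -(δ) by ring,
      show (x0 - x1) - (x0 - x1 - δ) = δ by ring] at h
    simp only [hf.neg] at h
    linear_combination h
  have key : f (η + y0 - y1) *
        (-(f (y1 - x0 + e) * f (y0 - x0) * f (η + (y1 - x1)) * f (y0 - x1 + (e + δ)) *
            f (η + x1 - x0) * A) +
          f (y1 - x1 + e) * f (y0 - x1) * f (η + (y1 - x0)) * f (y0 - x0 + (e + δ)) *
            f (η + x0 - x1) * A') * f δ -
      u * f (y0 - y1) *
        (-(f (y0 - x0 + (e + δ)) * f (y1 - x0) * f (η + (y0 - x1)) * f (y1 - x1 + e) *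
            f (η + x1 - x0) * B) +
          f (y0 - x1 + (e + δ)) * f (y1 - x1) * f (η + (y0 - x0)) * f (y1 - x0 + e) *
            f (η + x0 - x1) * B') * f δ -
      f (y0 - y1 + δ) * f η *
        (-(f (y0 - x0 + e) * f (y1 - x0) * f (η + (y0 - x1)) * f (y1 - x1 + (e + δ)) *
            f (η + x1 - x0) * A) +
          f (y0 - x1 + e) * f (y1 - x1) * f (η + (y0 - x0)) * f (y1 - x0 + (e + δ)) *
            f (η + x0 - x1) * A') = 0 := by
    -- After this multiplication `hA` and `hB` eliminate A' and B'; the coefficients of A and of B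
    -- then vanish separately.
    refine (mul_eq_zero.1 ?_).resolve_left (mul_ne_zero hx0 hδ)
    linear_combination
      f (x0 - x1) * (f (η + y0 - y1) * f (y0 - x1) * f (η + (y1 - x0)) * f δ *
          (f (y1 - x1 + e) * f (y0 - x0 + (e + δ))) -
        f (y0 - y1 + δ) * f η * (f (y0 - x1 + e) * f (y1 - x0 + (e + δ))) *
          (f (y1 - x1) * f (η + (y0 - x0)))) * hA -
      f (x0 - x1) * u * f (y0 - y1) * f δ * (f (y0 - x1 + (e + δ)) * f (y1 - x0 + e)) *
        (f (y1 - x1) * f (η + (y0 - x0))) * hB +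
      A * (-f δ * f η * (f (y1 - x0) * f (η + (y0 - x1))) * f (η + x1 - x0) * r124 +
        f (x0 - x1 + δ) * f η ^ 2 * (f (y1 - x1) * f (η + (y0 - x0))) * r123 +
        f (x0 - x1 + δ) * f η * f δ * (f (y1 - x1 + e) * f (y0 - x0 + (e + δ))) * t1 -
        (f (y0 - x1 + (e + δ)) * f (y1 - x0 + e)) * f δ ^ 2 * f (η + x1 - x0) * t2 -
        (f (y0 - x1 + (e + δ)) * f (y1 - x0 + e)) * f (y0 - y1) *
          (f (y1 - x1) * f (η + (y0 - x0))) * t0 -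
        f (y0 - y1) * f (x0 - x1) ^ 2 * (f (y0 - x1 + (e + δ)) * f (y1 - x0 + e)) *
          (f (y1 - x1) * f (η + (y0 - x0))) * huv) +
      f (x0 - x1) * B * u * f δ * (f η * (f (y1 - x1) * f (η + (y0 - x0))) * r123 +
        (f (y1 - x1 + e) * f (y0 - x0 + (e + δ))) * f δ * t1)
  rw [hx']
  field_simp
  linear_combination key

/-- The first of the two relations at the level where the second element appears. -/
lemma exchange_base_left (hf : IsThetaLike f) (x y0 y1 δ η : ℂ) :
    (f (η + y0 - y1) * f (y1 - x + (η - δ)) * f (y0 - x) * f δ)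
    + f (y0 - y1) * f (η + (y0 - x)) * f (y1 - x - δ) * f (η - δ)
    - f (y0 - y1 + δ) * f η * f (y0 - x + (η - δ)) * f (y1 - x) = 0 := by
  have h := hf.pairs (η + y0 - y1) (y1 - x + (η - δ)) (η + (y0 - x)) (η - δ) η (y0 - x + (η - δ)) (by ring) (by ring)
  rw [show (η + (y0 - x)) - η = y0 - x by ring,
    show (η + (y0 - x)) - (y0 - x + (η - δ)) = δ by ring,
    show η - (η + y0 - y1) = -(y0 - y1) by ring,
    show η - (y1 - x + (η - δ)) = -(y1 - x - δ) by ring,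
    show (η + y0 - y1) - (η + (y0 - x)) = -(y1 - x) by ring,
    show (η + y0 - y1) - (η - δ) = y0 - y1 + δ by ring] at h
  simp only [hf.neg] at h
  linear_combination h

/-- The second of the two relations at the level where the second element appears. -/
lemma exchange_base_right (hf : IsThetaLike f) (x y0 y1 δ η : ℂ) :
    -(f δ * f (η + y0 - y1) * f (η + (y1 - x)) * f (y0 - x - δ))
    + f (y0 - y1) * f (η + δ) * f (y0 - x + (η - δ)) * f (y1 - x)
    - f (y0 - y1 - δ) * f η * f (η + (y0 - x)) * f (y1 - x - δ) = 0 := by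
  have h := hf.pairs δ (η + y0 - y1) (y0 - y1) (η + δ) (η + (y0 - x)) (-(y1 - x - δ)) (by ring) (by ring)
  rw [show (y0 - y1) - (η + (y0 - x)) = -(η + (y1 - x)) by ring,
    show (y0 - y1) - (-(y1 - x - δ)) = y0 - x - δ by ring,
    show (η + (y0 - x)) - δ = y0 - x + (η - δ) by ring,
    show (η + (y0 - x)) - (η + y0 - y1) = y1 - x by ring,
    show δ - (y0 - y1) = -(y0 - y1 - δ) by ring,
    show δ - (η + δ) = -(η) by ring] at h
  simp only [hf.neg] at h
  linear_combination h

end IsThetaLike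

/-! ### Two elements of prescribed colours, level by level -/

/-- The factors of the weight function at level `k` that involve only two neighbouring elements of
colours `α`, `β`, with dynamical shifts `d0`, `d1`, variables `x0`, `x1` at level `k` and variables
`y0`, `y1` at level `k + 1`. -/
noncomputable def pairFactor (f : ℂ → ℂ) (η : ℂ) (α β k : ℕ) (d0 d1 x0 x1 y0 y1 : ℂ) : ℂ :=
  (if α < k then f (y0 - x0 + d0) / f d0 else 1) *
    (if α < k ∧ β < k + 1 then f (y1 - x0) else 1) *
    (if β < k ∧ α < k + 1 then f (η + (y0 - x1)) else 1) *
    (if β < k then f (y1 - x1 + d1) / f d1 else 1) *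
    (if α < k ∧ β < k then f (η + x1 - x0) / f (x1 - x0) else 1)

/-- The sum over the exchanges of the two variables `X0 k`, `X1 k` at the levels `1 ≤ k ≤ m` of the
product of the factors `L k`; the arguments are the variables at level `m + 1`. -/
noncomputable def chain (L : ℕ → ℂ → ℂ → ℂ → ℂ → ℂ) (X0 X1 : ℕ → ℂ) : ℕ → ℂ → ℂ → ℂ
  | 0, _, _ => 1
  | m + 1, y0, y1 =>
    L (m + 1) (X0 (m + 1)) (X1 (m + 1)) y0 y1 * chain L X0 X1 m (X0 (m + 1)) (X1 (m + 1)) +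
      L (m + 1) (X1 (m + 1)) (X0 (m + 1)) y0 y1 * chain L X0 X1 m (X1 (m + 1)) (X0 (m + 1))

section

variable {f : ℂ → ℂ} {η : ℂ} {α β : ℕ} {X0 X1 : ℕ → ℂ}

/-- By induction the inner chain is symmetric and factors out of both summands, which leaves
`exchange_same`. At levels k ≤ α neither element is present and all factors are 1. -/
lemma chain_symm_of_same (hf : IsThetaLike f) {d0 d1 : ℕ → ℂ} (m : ℕ)
    (hd : ∀ k, α < k → d1 k = d0 k + η)
    (h0 : ∀ k, α < k → k ≤ m → f (d0 k) ≠ 0) (h1 : ∀ k, α < k → k ≤ m → f (d1 k) ≠ 0)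
    (hX : ∀ k, α < k → k ≤ m → f (X1 k - X0 k) ≠ 0) (y0 y1 : ℂ) :
    chain (fun k => pairFactor f η α α k (d0 k) (d1 k)) X0 X1 m y1 y0 =
      chain (fun k => pairFactor f η α α k (d0 k) (d1 k)) X0 X1 m y0 y1 := by
  induction m generalizing y0 y1 with
  | zero => rfl
  | succ m ih =>
    simp only [chain]
    rw [ih (fun k hk hm => h0 k hk (by omega)) (fun k hk hm => h1 k hk (by omega))
      (fun k hk hm => hX k hk (by omega)) (X0 (m + 1)) (X1 (m + 1))]
    by_cases hm : α < m + 1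
    · have hm' : α < m + 1 + 1 := by omega
      have h := hf.exchange_same η (d0 (m + 1)) (d1 (m + 1)) (X0 (m + 1)) (X1 (m + 1)) y0 y1
        (hd _ hm) (h0 _ hm le_rfl) (h1 _ hm le_rfl) (hX _ hm le_rfl)
      simp only [pairFactor, hm, hm', and_self, if_true]
      rw [← add_mul, ← add_mul, h]
    · simp [pairFactor, hm]

/-- An element of colour c is present only at levels k > c, so here at most the element of colour α
is present. The order of the colours decides which slot it occupies, and both slots carry the same
variable. -/
lemma chain_eq_of_not_both {d0 d1 e0 e1 : ℕ → ℂ} (m : ℕ)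
    (hm : m < β) (hde : ∀ k, α < k → k < β → e1 k = d0 k)
    (hX : ∀ k, k ≤ β → X1 k = X0 k) (y : ℂ) :
    chain (fun k => pairFactor f η β α k (e0 k) (e1 k)) X0 X1 m y y =
      chain (fun k => pairFactor f η α β k (d0 k) (d1 k)) X0 X1 m y y := by
  induction m generalizing y with
  | zero => rfl
  | succ m ih =>
    have h1 : ¬β < m + 1 := by omega
    have h2 : ¬β < m + 1 + 1 := by omega
    simp only [chain, hX (m + 1) hm.le, ih (by omega), pairFactor, h1, h2, false_and, and_false,
      if_false, one_mul, mul_one]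
    by_cases h : α < m + 1
    · simp [h, hde _ h hm]
    · simp [h]

/-- The two relations between the chains for the colours `(α, β)` and `(β, α)`, `α < β`. -/
lemma chain_exchange (hf : IsThetaLike f) {d0 d1 e0 e1 : ℕ → ℂ} {δ v : ℂ} (hαβ : α < β) (m : ℕ)
    (hm : β ≤ m)
    (hlow : ∀ k, α < k → k < β → e1 k = d0 k) (hd : d0 β = η - δ) (he : e1 β = -δ)
    (hhigh : ∀ k, β < k → d1 k = d0 k + δ ∧ e0 k = d1 k ∧ e1 k = d0 k)
    (hXlow : ∀ k, k ≤ β → X1 k = X0 k)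
    (hX : ∀ k, β < k → k ≤ m → f (X1 k - X0 k) ≠ 0)
    (h0 : ∀ k, β ≤ k → k ≤ m → f (d0 k) ≠ 0) (h1 : ∀ k, β < k → k ≤ m → f (d1 k) ≠ 0)
    (hδ : f δ ≠ 0) (hv : v * f δ ^ 2 = -(f (η + δ) * f (η - δ))) (y0 y1 : ℂ) :
    f (η + y0 - y1) * chain (fun k => pairFactor f η α β k (d0 k) (d1 k)) X0 X1 m y1 y0 * f δ =
        1 * f (y0 - y1) * chain (fun k => pairFactor f η β α k (e0 k) (e1 k)) X0 X1 m y0 y1 * f δ +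
          f (y0 - y1 + δ) * f η *
            chain (fun k => pairFactor f η α β k (d0 k) (d1 k)) X0 X1 m y0 y1 ∧
      f (η + y0 - y1) * chain (fun k => pairFactor f η β α k (e0 k) (e1 k)) X0 X1 m y1 y0 * f δ =
        v * f (y0 - y1) * chain (fun k => pairFactor f η α β k (d0 k) (d1 k)) X0 X1 m y0 y1 * f δ -
          f (y0 - y1 - δ) * f η *
            chain (fun k => pairFactor f η β α k (e0 k) (e1 k)) X0 X1 m y0 y1 := by
  induction m, hm using Nat.le_induction generalizing y0 y1 with
  | base =>
    obtain ⟨b, rfl⟩ : ∃ b, β = b + 1 := ⟨β - 1, by omega⟩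
    have hb2 : α < b + 1 + 1 := by omega
    have hη := h0 _ le_rfl le_rfl
    rw [hd] at hη
    -- At level β both slots carry one variable, so the two summands of each chain coincide; this is
    -- the origin of the factor 2 below.
    simp only [chain, hXlow (b + 1) le_rfl,
      chain_eq_of_not_both (f := f) (η := η) (d1 := d1) (e0 := e0) b (Nat.lt_succ_self b) hlow hXlow]
    generalize chain _ X0 X1 b _ _ = C
    simp only [pairFactor, hαβ, hb2, lt_irrefl, Nat.lt_succ_self, and_true, and_false,
      if_true, if_false, one_mul, mul_one, hd, he, hf.neg, ← sub_eq_add_neg]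
    have hl := hf.exchange_base_left (X0 (b + 1)) y0 y1 δ η
    have hr := hf.exchange_base_right (X0 (b + 1)) y0 y1 δ η
    constructor
    · field_simp
      linear_combination 2 * C * hl
    · have hv' : v = -(f (η + δ) * f (η - δ)) / f δ ^ 2 := by field_simp; exact hv
      rw [hv']
      field_simp
      linear_combination 2 * C * hr
  | succ m hm ih =>
    obtain ⟨hd1, he0, he1⟩ := hhigh (m + 1) (by omega)
    have hβ1 : β < m + 1 := by omega
    have hβ2 : β < m + 1 + 1 := by omega
    have hα1 : α < m + 1 := by omega
    have hα2 : α < m + 1 + 1 := by omega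
    have ih' := ih (fun k hk hm => hX k hk (by omega)) (fun k hk hm => h0 k hk (by omega))
      (fun k hk hm => h1 k hk (by omega)) (X0 (m + 1)) (X1 (m + 1))
    simp only [chain, pairFactor, hβ1, hβ2, hα1, hα2, and_self, if_true, he0, he1]
    refine ⟨hf.exchange_step y0 y1 hd1 (h0 _ (by omega) le_rfl) (h1 _ (by omega) le_rfl)
      (hX _ (by omega) le_rfl) hδ (by rw [one_mul, hv]) ih'.1 ih'.2, ?_⟩
    -- The second relation is the first one with the roles of the two chains exchanged, δ replaced
    -- by -δ, and u and v interchanged.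
    have := hf.exchange_step (η := η) (δ := -δ) (u := v) (v := 1) y0 y1
      (show d0 (m + 1) = d1 (m + 1) + -δ by rw [hd1]; ring) (h1 _ (by omega) le_rfl)
      (h0 _ (by omega) le_rfl)
      (hX _ (by omega) le_rfl) (by rw [hf.neg]; exact neg_ne_zero.2 hδ)
      (by rw [hf.neg, mul_one, neg_sq, hv]; ring_nf)
      (A := chain (fun k => pairFactor f η β α k (e0 k) (e1 k)) X0 X1 m (X0 (m + 1)) (X1 (m + 1)))
      (A' := chain (fun k => pairFactor f η β α k (e0 k) (e1 k)) X0 X1 m (X1 (m + 1)) (X0 (m + 1)))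
      (B := chain (fun k => pairFactor f η α β k (d0 k) (d1 k)) X0 X1 m (X0 (m + 1)) (X1 (m + 1)))
      (B' := chain (fun k => pairFactor f η α β k (d0 k) (d1 k)) X0 X1 m (X1 (m + 1)) (X0 (m + 1)))
      (by rw [hf.neg, ← sub_eq_add_neg]; linear_combination -ih'.2)
      (by rw [hf.neg, sub_neg_eq_add]; linear_combination -ih'.1)
    rw [hf.neg, ← sub_eq_add_neg] at this
    linear_combination -this

end

/-! ### Weight functions indexed by elements

Here `c e` is the (natural number) colour of the element `e`, and `T k e` the variable of level `k`
attached to `e`, which is relevant for `c e < k` only. -/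

section

variable {n : ℕ}

/-- The number of elements of colour `k` before `e`. -/
def countBefore (c : Fin n → ℕ) (k : ℕ) (e : Fin n) : ℕ :=
  (Finset.univ.filter fun e' => c e' = k ∧ e' < e).card

/-- The dynamical shift of the element `e` at level `k`. -/
def elementShift (c : Fin n → ℕ) (η : ℂ) (μ : ℕ → ℂ) (e : Fin n) (k : ℕ) : ℂ :=
  (1 + (countBefore c (c e) e : ℂ) - (countBefore c k e : ℂ)) * η + μ k - μ (c e)

/-- The factor of the weight function of the variable of `e` at level `k` and the variable of `e'`
at level `k + 1`. -/
noncomputable def crossFactor (f : ℂ → ℂ) (η : ℂ) (d : Fin n → ℕ → ℂ) (c : Fin n → ℕ)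
    (T : ℕ → Fin n → ℂ) (k : ℕ) (e e' : Fin n) : ℂ :=
  if c e < k ∧ c e' < k + 1 then
    if e' < e then f (η + (T (k + 1) e' - T k e))
    else if e' = e then f (T (k + 1) e' - T k e + d e k) / f (d e k)
    else f (T (k + 1) e' - T k e)
  else 1

/-- The factor of the weight function of the variables of `e` and `e'` at level `k`. -/
noncomputable def sameFactor (f : ℂ → ℂ) (η : ℂ) (c : Fin n → ℕ)
    (T : ℕ → Fin n → ℂ) (k : ℕ) (e e' : Fin n) : ℂ :=
  if c e < k ∧ c e' < k ∧ e < e' then f (η + T k e' - T k e) / f (T k e' - T k e) else 1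

/-- The factors of level `k` of the weight function that do not involve only the elements
`i` and `i'`. -/
noncomputable def outerFactor (f : ℂ → ℂ) (η : ℂ) (i i' : Fin n) (d : Fin n → ℕ → ℂ)
    (c : Fin n → ℕ) (T : ℕ → Fin n → ℂ) (k : ℕ) : ℂ :=
  (∏ e, ∏ e', if (e = i ∨ e = i') ∧ (e' = i ∨ e' = i') then 1 else crossFactor f η d c T k e e') *
    ∏ e, ∏ e', if (e = i ∨ e = i') ∧ (e' = i ∨ e' = i') then 1 else sameFactor f η c T k e e'

variable {f : ℂ → ℂ} {η : ℂ} {i i' : Fin n}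

lemma prod_prod_eq_pair_mul (hi : i ≠ i') (g : Fin n → Fin n → ℂ) :
    ∏ e, ∏ e', g e e' =
      (∏ e, ∏ e', if (e = i ∨ e = i') ∧ (e' = i ∨ e' = i') then 1 else g e e') *
        (g i i * g i i' * (g i' i * g i' i')) := by
  have hsplit : ∀ e e', g e e' =
      (if (e = i ∨ e = i') ∧ (e' = i ∨ e' = i') then 1 else g e e') *
        (if e = i ∨ e = i' then (if e' = i ∨ e' = i' then g e e' else 1) else 1) := by
    intro e e'
    by_cases h : e = i ∨ e = i' <;> by_cases h' : e' = i ∨ e' = i' <;> simp [h, h']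
  have hpair : ∀ h : Fin n → ℂ, (∏ e, if e = i ∨ e = i' then h e else 1) = h i * h i' := by
    intro h
    rw [← Finset.prod_filter, show (Finset.univ.filter fun e => e = i ∨ e = i') = {i, i'} by
      ext e; simp, Finset.prod_pair hi]
  conv_lhs => enter [2, e, 2, e']; rw [hsplit e e']
  simp_rw [Finset.prod_mul_distrib]
  congr 1
  rw [← hpair (fun e' => g i e'), ← hpair (fun e' => g i' e'),
    ← hpair (fun e => ∏ e', if e' = i ∨ e' = i' then g e e' else 1)]
  refine Finset.prod_congr rfl fun e _ => ?_
  split_ifs <;> simp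

lemma prod_levelFactor_eq (hi : (i' : ℕ) = i + 1) (d : Fin n → ℕ → ℂ) (c : Fin n → ℕ)
    (T : ℕ → Fin n → ℂ) (k : ℕ) :
    (∏ e, ∏ e', crossFactor f η d c T k e e') * (∏ e, ∏ e', sameFactor f η c T k e e') =
      outerFactor f η i i' d c T k *
        pairFactor f η (c i) (c i') k (d i k) (d i' k) (T k i) (T k i') (T (k + 1) i)
          (T (k + 1) i') := by
  have hlt : i < i' := Fin.lt_def.2 (by omega)
  rw [prod_prod_eq_pair_mul hlt.ne (crossFactor f η d c T k),
    prod_prod_eq_pair_mul hlt.ne (sameFactor f η c T k), outerFactor]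
  rw [mul_mul_mul_comm]
  congr 1
  have h1 : ∀ a : ℕ, (a < k ∧ a < k + 1) ↔ a < k := fun a => by omega
  simp only [crossFactor, sameFactor, pairFactor, lt_irrefl, hlt, hlt.not_gt, hlt.ne, hlt.ne', h1,
    if_true, if_false, and_false, and_true, one_mul, mul_one]
  ring

/-- As i and i' are adjacent, a third element compares in the same way with both. The permutations ρ
and ρ' may differ, since they will belong to neighbouring levels. -/
lemma swap_lt_swap_iff (hi : (i' : ℕ) = i + 1) {ρ ρ' : Equiv.Perm (Fin n)}
    (hρ : ρ = 1 ∨ ρ = Equiv.swap i i') (hρ' : ρ' = 1 ∨ ρ' = Equiv.swap i i') {e e' : Fin n}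
    (h : ¬((e = i ∨ e = i') ∧ (e' = i ∨ e' = i'))) : ρ e < ρ' e' ↔ e < e' := by
  rcases hρ with rfl | rfl <;> rcases hρ' with rfl | rfl <;>
    simp only [Equiv.Perm.one_apply, Equiv.swap_apply_def] <;> (try split_ifs) <;>
    simp only [Fin.lt_def, Fin.ext_iff] at * <;> omega

lemma perm_mem_pair_iff {ρ : Equiv.Perm (Fin n)} (hρ : ρ = 1 ∨ ρ = Equiv.swap i i') (e : Fin n) :
    (ρ e = i ∨ ρ e = i') ↔ (e = i ∨ e = i') := by
  rcases hρ with rfl | rfl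
  · rfl
  · rw [Equiv.swap_apply_def]
    split_ifs with h h' <;> simp [*]

lemma perm_apply_of_not_mem_pair {ρ : Equiv.Perm (Fin n)} (hρ : ρ = 1 ∨ ρ = Equiv.swap i i')
    {e : Fin n} (h : ¬(e = i ∨ e = i')) : ρ e = e := by
  rcases hρ with rfl | rfl
  · rfl
  · push Not at h
    exact Equiv.swap_apply_of_ne_of_ne h.1 h.2

/-- Exchanging `i` and `i'` at some levels does not affect the outer factor. -/
lemma outerFactor_eq_of_perm (hi : (i' : ℕ) = i + 1) {d d' : Fin n → ℕ → ℂ} {c c' : Fin n → ℕ}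
    {T T' : ℕ → Fin n → ℂ} {k : ℕ} {ρ ρ' : Equiv.Perm (Fin n)}
    (hρ : ρ = 1 ∨ ρ = Equiv.swap i i') (hρ' : ρ' = 1 ∨ ρ' = Equiv.swap i i')
    (hd : ∀ e, ¬(e = i ∨ e = i') → d' e k = d e k)
    (hc : ∀ e, c' (ρ e) < k ↔ c e < k) (hc' : ∀ e, c' (ρ' e) < k + 1 ↔ c e < k + 1)
    (hT : ∀ e, c e < k → T' k (ρ e) = T k e)
    (hT' : ∀ e, c e < k + 1 → T' (k + 1) (ρ' e) = T (k + 1) e) :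
    outerFactor f η i i' d' c' T' k = outerFactor f η i i' d c T k := by
  unfold outerFactor
  congr 1
  · rw [← Equiv.prod_comp ρ]
    refine Finset.prod_congr rfl fun e _ => ?_
    rw [← Equiv.prod_comp ρ']
    refine Finset.prod_congr rfl fun e' _ => ?_
    simp only [perm_mem_pair_iff hρ, perm_mem_pair_iff hρ']
    by_cases h : (e = i ∨ e = i') ∧ (e' = i ∨ e' = i')
    · simp only [h, and_self, if_true]
    · simp only [if_neg h, crossFactor, hc, hc']
      by_cases hcc : c e < k ∧ c e' < k + 1
      · have h1 := swap_lt_swap_iff hi hρ hρ' h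
        have h2 := swap_lt_swap_iff hi hρ' hρ (fun h' => h h'.symm)
        have h3 : ρ' e' = ρ e ↔ e' = e := by
          rw [← not_iff_not]
          simp only [← ne_eq, ne_iff_lt_or_gt, h1, h2]
        simp only [if_pos hcc, h2, h3, hT e hcc.1, hT' e' hcc.2]
        by_cases he : e' = e
        · subst he
          have he' : ¬(e' = i ∨ e' = i') := fun h' => h ⟨h', h'⟩
          rw [perm_apply_of_not_mem_pair hρ he', hd e' he']
        · simp only [if_neg he]
      · simp only [if_neg hcc]
  · rw [← Equiv.prod_comp ρ]
    refine Finset.prod_congr rfl fun e _ => ?_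
    rw [← Equiv.prod_comp ρ]
    refine Finset.prod_congr rfl fun e' _ => ?_
    simp only [perm_mem_pair_iff hρ]
    by_cases h : (e = i ∨ e = i') ∧ (e' = i ∨ e' = i')
    · simp only [h, and_self, if_true]
    · simp only [if_neg h, sameFactor, hc, swap_lt_swap_iff hi hρ hρ h]
      by_cases hcc : c e < k ∧ c e' < k ∧ e < e'
      · simp only [if_pos hcc, hT e hcc.1, hT e' hcc.2.1]
      · simp only [if_neg hcc]

/-- For e ≠ i', either both of i, i' precede e or neither does. -/
lemma countBefore_comp_swap (hi : (i' : ℕ) = i + 1) (c : Fin n → ℕ) (k : ℕ) {e : Fin n}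
    (he : e ≠ i') : countBefore (c ∘ Equiv.swap i i') k e = countBefore c k e := by
  unfold countBefore
  refine Finset.card_equiv (Equiv.swap i i') fun e' => ?_
  have : Equiv.swap i i' e' < e ↔ e' < e := by
    rw [Equiv.swap_apply_def]
    split_ifs <;> simp only [Fin.lt_def, Fin.ext_iff, ne_eq] at * <;> omega
  simp [this]

lemma countBefore_succ (hi : (i' : ℕ) = i + 1) (c : Fin n → ℕ) (k : ℕ) :
    countBefore c k i' = countBefore c k i + if c i = k then 1 else 0 := by
  unfold countBefore
  have hlt : ∀ e : Fin n, e < i' ↔ e < i ∨ e = i := fun e => by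
    simp only [Fin.lt_def, Fin.ext_iff]; omega
  split_ifs with h
  · rw [← Finset.card_insert_of_notMem (a := i) (by simp)]
    congr 1
    ext e
    simp only [Finset.mem_filter, Finset.mem_univ, true_and, Finset.mem_insert, hlt]
    constructor
    · rintro ⟨h1, h2 | h2⟩ <;> tauto
    · rintro (rfl | h2) <;> tauto
  · rw [add_zero]
    congr 1
    ext e
    simp only [Finset.mem_filter, Finset.mem_univ, true_and, hlt]
    constructor
    · rintro ⟨h1, h2 | rfl⟩ <;> tauto
    · tauto

lemma elementShift_comp_swap (hi : (i' : ℕ) = i + 1) (c : Fin n → ℕ) (μ : ℕ → ℂ) (k : ℕ)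
    {e : Fin n} (he : ¬(e = i ∨ e = i')) :
    elementShift (c ∘ Equiv.swap i i') η μ e k = elementShift c η μ e k := by
  push Not at he
  unfold elementShift
  rw [countBefore_comp_swap hi c _ he.2, countBefore_comp_swap hi c _ he.2, Function.comp_apply,
    Equiv.swap_apply_of_ne_of_ne he.1 he.2]

lemma chain_congr {L : ℕ → ℂ → ℂ → ℂ → ℂ → ℂ} {X0 X1 Y0 Y1 : ℕ → ℂ} {m : ℕ}
    (h0 : ∀ k, k ≤ m → X0 k = Y0 k) (h1 : ∀ k, k ≤ m → X1 k = Y1 k) (y0 y1 : ℂ) :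
    chain L X0 X1 m y0 y1 = chain L Y0 Y1 m y0 y1 := by
  induction m generalizing y0 y1 with
  | zero => rfl
  | succ m ih =>
    simp only [chain, h0 _ le_rfl, h1 _ le_rfl,
      ih (fun k hk => h0 k (by omega)) (fun k hk => h1 k (by omega))]

/-- Summation over a family of variables that is stable under the exchange of `i` and `i'` at each
of the levels `1, …, m`. -/
lemma two_pow_mul_sum_eq_chain {Γ : Type*} [Fintype Γ] (T : Γ → ℕ → Fin n → ℂ)
    (L : ℕ → ℂ → ℂ → ℂ → ℂ → ℂ) (Z : (ℕ → Fin n → ℂ) → ℂ) (M m : ℕ) (hm : m ≤ M)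
    (hr : ∀ k, 1 ≤ k → k ≤ M → ∃ r : Equiv.Perm Γ, ∀ π,
      T (r π) = Function.update (T π) k (T π k ∘ Equiv.swap i i'))
    (hZ : ∀ k, 1 ≤ k → k ≤ M → ∀ π,
      Z (Function.update (T π) k (T π k ∘ Equiv.swap i i')) = Z (T π)) :
    2 ^ m * ∑ π, Z (T π) * ∏ k ∈ Finset.Ico 1 (M + 1),
        L k (T π k i) (T π k i') (T π (k + 1) i) (T π (k + 1) i') =
      ∑ π, Z (T π) * (chain L (fun k => T π k i) (fun k => T π k i') m (T π (m + 1) i)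
        (T π (m + 1) i') * ∏ k ∈ Finset.Ico (m + 1) (M + 1),
          L k (T π k i) (T π k i') (T π (k + 1) i) (T π (k + 1) i')) := by
  induction m with
  | zero => simp [chain]
  | succ m ih =>
    obtain ⟨r, hr'⟩ := hr (m + 1) (by omega) hm
    -- One of the two copies of the sum is reindexed by the exchange at level m + 1; the copies then
    -- give the two summands in the recursion for `chain`.
    rw [pow_succ', mul_assoc, ih (by omega), two_mul]
    conv_lhs => enter [2]; rw [← Equiv.sum_comp r]
    rw [← Finset.sum_add_distrib]
    refine Finset.sum_congr rfl fun π _ => ?_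
    rw [hr' π, hZ (m + 1) (by omega) hm, ← mul_add]
    congr 1
    have hIco : ∀ F : ℕ → ℂ, ∏ k ∈ Finset.Ico (m + 1) (M + 1), F k =
        F (m + 1) * ∏ k ∈ Finset.Ico (m + 1 + 1) (M + 1), F k :=
      fun F => Finset.prod_eq_prod_Ico_succ_bot (by omega) F
    simp only [hIco]
    set T' := Function.update (T π) (m + 1) (T π (m + 1) ∘ Equiv.swap i i') with hT'
    have hne : ∀ k, k ≠ m + 1 → T' k = T π k := fun k hk => Function.update_of_ne hk _ _
    have h0 : T' (m + 1) i = T π (m + 1) i' := by simp [hT']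
    have h1 : T' (m + 1) i' = T π (m + 1) i := by simp [hT']
    have hp : ∏ k ∈ Finset.Ico (m + 1 + 1) (M + 1),
          L k (T' k i) (T' k i') (T' (k + 1) i) (T' (k + 1) i') =
        ∏ k ∈ Finset.Ico (m + 1 + 1) (M + 1),
          L k (T π k i) (T π k i') (T π (k + 1) i) (T π (k + 1) i') := by
      refine Finset.prod_congr rfl fun k hk => ?_
      have := (Finset.mem_Ico.1 hk).1
      rw [hne k (by omega), hne (k + 1) (by omega)]
    rw [hp, h0, h1, hne (m + 1 + 1) (by omega), chain_congr (X0 := fun k => T' k i)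
      (X1 := fun k => T' k i') (Y0 := fun k => T π k i) (Y1 := fun k => T π k i')
      (fun k hk => by rw [hne k (by omega)]) (fun k hk => by rw [hne k (by omega)])]
    simp only [chain]
    ring

end

namespace BlockPartition

/-! ### Variables attached to elements -/

section

variable {n N : ℕ} {lam : Fin N → ℕ}

@[ext]
lemma ext_color {J K : BlockPartition n lam} (h : ∀ e, J.color e = K.color e) : J = K := by
  cases J; cases K
  simp only [mk.injEq]
  exact funext h

/-- The colour of an element as a natural number. -/
def colorNat (J : BlockPartition n lam) (e : Fin n) : ℕ := J.color e

/-- Parameters indexed by blocks as a function on the natural numbers. -/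
noncomputable def extendParam (μ : Fin N → ℂ) (k : ℕ) : ℂ := if h : k < N then μ ⟨k, h⟩ else 0

lemma extendParam_val (μ : Fin N → ℂ) (j : Fin N) : extendParam μ j = μ j := by
  simp [extendParam]

variable (J : BlockPartition n lam)

lemma mem_upTo {k : ℕ} {e : Fin n} : e ∈ J.upTo k ↔ J.colorNat e < k := by
  simp [upTo, colorNat]

lemma elt_strictMono (k : ℕ) : StrictMono (J.elt k) :=
  ((J.upTo k).orderEmbOfFin (J.card_upTo k)).strictMono

lemma colorNat_elt_lt (k : ℕ) (a : Fin (partialSum lam k)) : J.colorNat (J.elt k a) < k :=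
  J.mem_upTo.1 ((J.upTo k).orderEmbOfFin_mem (J.card_upTo k) a)

lemma exists_elt_eq {k : ℕ} {e : Fin n} (h : J.colorNat e < k) : ∃ a, J.elt k a = e := by
  have h' := J.mem_upTo.2 h
  rw [← Finset.mem_coe, ← (J.upTo k).range_orderEmbOfFin (J.card_upTo k)] at h'
  exact h'

lemma elt_eq_of_strictMono {k : ℕ} {g : Fin (partialSum lam k) → Fin n} (hg : StrictMono g)
    (h : ∀ a, J.colorNat (g a) < k) (a : Fin (partialSum lam k)) : J.elt k a = g a :=
  (congrFun (Finset.orderEmbOfFin_unique (J.card_upTo k) (fun a => J.mem_upTo.2 (h a)) hg) a).symm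

lemma prod_elt (k : ℕ) (g : Fin n → ℂ) :
    ∏ a, g (J.elt k a) = ∏ e, if J.colorNat e < k then g e else 1 := by
  rw [← Finset.prod_filter]
  refine Finset.prod_bij (fun a _ => J.elt k a) ?_ ?_ ?_ ?_
  · intro a _
    simpa using J.colorNat_elt_lt k a
  · intro a _ b _ h
    exact (J.elt_strictMono k).injective h
  · intro e he
    obtain ⟨a, ha⟩ := J.exists_elt_eq (Finset.mem_filter.1 he).2
    exact ⟨a, Finset.mem_univ _, ha⟩
  · intros; rfl

lemma prod_prod_elt (k l : ℕ) {G g : Fin n → Fin n → ℂ}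
    (h : ∀ e e', G e e' = if J.colorNat e < k ∧ J.colorNat e' < l then g e e' else 1) :
    ∏ e, ∏ e', G e e' = ∏ a, ∏ b, g (J.elt k a) (J.elt l b) := by
  rw [J.prod_elt k (fun e => ∏ b, g e (J.elt l b))]
  refine Finset.prod_congr rfl fun e _ => ?_
  rw [J.prod_elt l]
  split_ifs with he
  · exact Finset.prod_congr rfl fun e' _ => by simp [h, he]
  · exact Finset.prod_eq_one fun e' _ => by simp [h, he]

lemma p_eq_countBefore (j : Fin N) (e : Fin n) : J.p j e = countBefore J.colorNat j e := by
  unfold p countBefore block colorNat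
  rw [Finset.filter_filter]
  simp only [Fin.val_inj]

lemma dynShift_eq_elementShift (η : ℂ) (μ : Fin N → ℂ) (k : Finset.Ico 1 N)
    (a : Fin (partialSum lam k)) :
    J.dynShift η μ k a = elementShift J.colorNat η (extendParam μ) (J.elt k a) k := by
  have h := extendParam_val μ (nextBlock k)
  have h' := J.p_eq_countBefore (nextBlock k) (J.elt k a)
  simp only [nextBlock] at h h'
  simp only [dynShift, elementShift, nextBlock, h, h', p_eq_countBefore, colorNat, extendParam_val]

lemma U_eq_prod {τ η : ℂ} {μ : Fin N → ℂ} {t : Vars lam} {z : Fin n → ℂ} {T : ℕ → Fin n → ℂ}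
    (hT : ∀ k, 1 ≤ k → k ≤ N → ∀ a, T k (J.elt k a) = J.levelVar t z k a) :
    J.U τ η μ t z = ∏ k ∈ Finset.Ico 1 N,
      ((∏ e, ∏ e', crossFactor (theta τ) η (elementShift J.colorNat η (extendParam μ))
          J.colorNat T k e e') *
        ∏ e, ∏ e', sameFactor (theta τ) η J.colorNat T k e e') := by
  rw [← Finset.prod_coe_sort (Finset.Ico 1 N)]
  refine Finset.prod_congr rfl fun k _ => ?_
  have hk := Finset.mem_Ico.1 k.2
  have ht : ∀ a, t k a = T k (J.elt k a) := fun a => by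
    rw [hT k hk.1 hk.2.le, levelVar, dif_pos k.2]
  rw [Finset.prod_mul_distrib]
  congr 1
  · rw [J.prod_prod_elt k (k + 1) (G := crossFactor _ _ _ _ _ _) fun e e' => rfl]
    refine Finset.prod_congr rfl fun a _ => Finset.prod_congr rfl fun b _ => ?_
    simp only [psi, dynShift_eq_elementShift, ht, hT (k + 1) (by omega) (by omega)]
  · rw [J.prod_prod_elt k k (G := sameFactor _ _ _ _ _)
      (g := fun e e' => if e < e' then theta τ (η + T k e' - T k e) / theta τ (T k e' - T k e)
        else 1) fun e e' => ?_]
    · refine Finset.prod_congr rfl fun a _ => ?_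
      rw [Finset.prod_filter]
      refine Finset.prod_congr rfl fun b _ => ?_
      simp only [(J.elt_strictMono k).lt_iff_lt, ht]
    · unfold sameFactor
      split_ifs <;> simp_all

/-- The variables of level `k` attached to the elements of `J`; a level that contains only one of
`i`, `i'` attaches its variable to both. -/
noncomputable def place (i i' : Fin n) (t : Vars lam) (z : Fin n → ℂ) (k : ℕ) (e : Fin n) : ℂ :=
  if J.colorNat e < k then Function.extend (J.elt k) (J.levelVar t z k) 0 e
  else Function.extend (J.elt k) (J.levelVar t z k) 0 (Equiv.swap i i' e)

variable {i i' : Fin n}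

lemma place_elt (t : Vars lam) (z : Fin n → ℂ) (k : ℕ) (a : Fin (partialSum lam k)) :
    J.place i i' t z k (J.elt k a) = J.levelVar t z k a := by
  rw [place, if_pos (J.colorNat_elt_lt k a), (J.elt_strictMono k).injective.extend_apply]

lemma extend_elt_of_not_lt {k : ℕ} (g : Fin (partialSum lam k) → ℂ) {e : Fin n}
    (h : ¬J.colorNat e < k) : Function.extend (J.elt k) g 0 e = 0 := by
  rw [Function.extend_apply', Pi.zero_apply]
  rintro ⟨a, rfl⟩
  exact h (J.colorNat_elt_lt k a)

/-- Giving both elements the same variable makes the exchange trivial at such a level, so that these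
levels too contribute a factor 2 to the averaging. -/
lemma place_swap_of_not_both {k : ℕ} (h : ¬(J.colorNat i < k ∧ J.colorNat i' < k))
    (t : Vars lam) (z : Fin n → ℂ) (e : Fin n) :
    J.place i i' t z k (Equiv.swap i i' e) = J.place i i' t z k e := by
  have key : J.place i i' t z k i' = J.place i i' t z k i := by
    unfold place
    rw [Equiv.swap_apply_left, Equiv.swap_apply_right]
    split_ifs with h1 h2 h2
    · exact absurd ⟨h2, h1⟩ h
    · rfl
    · rfl
    · rw [J.extend_elt_of_not_lt _ h1, J.extend_elt_of_not_lt _ h2]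
  rw [Equiv.swap_apply_def]
  split_ifs with h1 h2
  · rw [h1, key]
  · rw [h2, key]
  · rfl

lemma colorNat_perm_swap (e : Fin n) :
    (J.perm (Equiv.swap i i')).colorNat e = J.colorNat (Equiv.swap i i' e) := by
  simp [colorNat, perm]

lemma elt_perm_swap_of_not_both (hi : (i' : ℕ) = i + 1) {k : ℕ}
    (h : ¬(J.colorNat i < k ∧ J.colorNat i' < k)) (a : Fin (partialSum lam k)) :
    (J.perm (Equiv.swap i i')).elt k a = Equiv.swap i i' (J.elt k a) := by
  refine elt_eq_of_strictMono _ (g := fun a => Equiv.swap i i' (J.elt k a)) ?_ ?_ a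
  · intro a b hab
    have ha := J.colorNat_elt_lt k a
    have hb := J.colorNat_elt_lt k b
    refine (swap_lt_swap_iff hi (.inr rfl) (.inr rfl) ?_).2 (J.elt_strictMono k hab)
    have hne := (J.elt_strictMono k hab).ne
    rintro ⟨h1 | h1, h2 | h2⟩
    · exact hne (h1.trans h2.symm)
    · exact h ⟨h1 ▸ ha, h2 ▸ hb⟩
    · exact h ⟨h2 ▸ hb, h1 ▸ ha⟩
    · exact hne (h1.trans h2.symm)
  · intro a
    rw [colorNat_perm_swap, Equiv.swap_apply_self]
    exact J.colorNat_elt_lt k a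

lemma colorNat_swap_lt_of_both {k : ℕ} (h : J.colorNat i < k ∧ J.colorNat i' < k) (e : Fin n) :
    J.colorNat (Equiv.swap i i' e) < k ↔ J.colorNat e < k := by
  rw [Equiv.swap_apply_def]
  split_ifs with h1 h2
  · simp [h1, h]
  · simp [h2, h]
  · rfl

lemma elt_perm_swap_of_both {k : ℕ} (h : J.colorNat i < k ∧ J.colorNat i' < k)
    (a : Fin (partialSum lam k)) : (J.perm (Equiv.swap i i')).elt k a = J.elt k a := by
  refine elt_eq_of_strictMono _ (J.elt_strictMono k) (fun a => ?_) a
  rw [colorNat_perm_swap, colorNat_swap_lt_of_both J h]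
  exact J.colorNat_elt_lt k a

/-- A single placement, built from J, serves J and its image under the exchange. If both elements
are present at level k, the two partitions have the same set of elements there; otherwise the
exchange maps one set to the other monotonically. -/
lemma place_elt_perm_swap (hi : (i' : ℕ) = i + 1) (t : Vars lam) (z : Fin n → ℂ) (k : ℕ)
    (a : Fin (partialSum lam k)) :
    J.place i i' t z k ((J.perm (Equiv.swap i i')).elt k a) =
      (J.perm (Equiv.swap i i')).levelVar t z k a := by
  by_cases h : J.colorNat i < k ∧ J.colorNat i' < k
  · rw [elt_perm_swap_of_both J h, place_elt]; rfl
  · rw [elt_perm_swap_of_not_both J hi h, place_swap_of_not_both J h, place_elt]; rfl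

lemma elt_self_eq_castLE (a : Fin (partialSum lam N)) :
    J.elt N a = Fin.castLE (J.partialSum_le N) a :=
  J.elt_eq_of_strictMono (g := Fin.castLE (J.partialSum_le N)) (Fin.strictMono_castLE _)
    (fun _ => (J.color _).2) a

lemma place_last (t : Vars lam) (z : Fin n → ℂ) (e : Fin n) : J.place i i' t z N e = z e := by
  obtain ⟨a, rfl⟩ := J.exists_elt_eq (J.color e).2
  rw [place_elt, levelVar, dif_neg (by simp), elt_self_eq_castLE]

/-- The exchange of the variables of `i` and `i'` at level `k` is a permutation of the variables of
this level. -/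
lemma exists_place_eq_update (z : Fin n → ℂ) (t : Vars lam) {k : ℕ} (hk : k ∈ Finset.Ico 1 N) :
    ∃ r : Equiv.Perm ((k : Finset.Ico 1 N) → Equiv.Perm (Fin (partialSum lam k))), ∀ π,
      J.place i i' (fun k a => t k (r π k a)) z =
        Function.update (J.place i i' (fun k a => t k (π k a)) z) k
          (J.place i i' (fun k a => t k (π k a)) z k ∘ Equiv.swap i i') := by
  by_cases h : J.colorNat i < k ∧ J.colorNat i' < k
  · obtain ⟨a, ha⟩ := J.exists_elt_eq h.1
    obtain ⟨b, hb⟩ := J.exists_elt_eq h.2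
    let g : (k : Finset.Ico 1 N) → Equiv.Perm (Fin (partialSum lam k)) :=
      Pi.mulSingle ⟨k, hk⟩ (Equiv.swap a b)
    -- Multiplication is on the right because the transposition acts on the positions, before π.
    refine ⟨Equiv.mulRight g, fun π => funext fun l => ?_⟩
    by_cases hl : l = k
    · subst hl
      rw [Function.update_self]
      funext e
      by_cases he : J.colorNat e < l
      · obtain ⟨c, rfl⟩ := J.exists_elt_eq he
        have hsw : Equiv.swap i i' (J.elt l c) = J.elt l (Equiv.swap a b c) := by
          rw [← ha, ← hb, (J.elt_strictMono l).injective.swap_apply]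
        rw [Function.comp_apply, hsw, place_elt, place_elt, levelVar, levelVar, dif_pos hk,
          dif_pos hk]
        simp [g]
      · have h1 : e ≠ i := fun h1 => he (h1 ▸ h.1)
        have h2 : e ≠ i' := fun h2 => he (h2 ▸ h.2)
        rw [Function.comp_apply, Equiv.swap_apply_of_ne_of_ne h1 h2]
        simp only [place, if_neg he, Equiv.swap_apply_of_ne_of_ne h1 h2,
          J.extend_elt_of_not_lt _ he]
    · rw [Function.update_of_ne hl]
      have hlev : J.levelVar (fun k a => t k ((Equiv.mulRight g) π k a)) z l =
          J.levelVar (fun k a => t k (π k a)) z l := by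
        funext c
        unfold levelVar
        split_ifs with hl'
        · have hg : g ⟨l, hl'⟩ = 1 := Pi.mulSingle_eq_of_ne (by simpa using hl) _
          simp [hg]
        · rfl
      funext e
      simp only [place, hlev]
  · refine ⟨1, fun π => ?_⟩
    have : J.place i i' (fun k a => t k (π k a)) z k ∘ Equiv.swap i i' =
        J.place i i' (fun k a => t k (π k a)) z k :=
      funext fun e => J.place_swap_of_not_both h _ _ e
    rw [this, Function.update_eq_self]
    rfl

end

end BlockPartition

/-! ### Dynamical shifts and chains of two neighbouring elements. -/

section

variable {n : ℕ} {f : ℂ → ℂ} {η : ℂ} {i i' : Fin n}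

/-- The factors of the weight function that involve only `i` and `i'`, for the colouring `c`. -/
noncomputable def elementPairFactor (f : ℂ → ℂ) (η : ℂ) (μ : ℕ → ℂ) (i i' : Fin n)
    (c : Fin n → ℕ) (k : ℕ) : ℂ → ℂ → ℂ → ℂ → ℂ :=
  pairFactor f η (c i) (c i') k (elementShift c η μ i k) (elementShift c η μ i' k)

lemma chain_elementPairFactor_symm (hf : IsThetaLike f) (hi : (i' : ℕ) = i + 1) {c : Fin n → ℕ}
    {μ : ℕ → ℂ} {X0 X1 : ℕ → ℂ} {m : ℕ} (hc : c i = c i')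
    (hreg : ∀ e k, c e < k → k ≤ m → f (elementShift c η μ e k) ≠ 0)
    (hX : ∀ k, c i < k → k ≤ m → f (X1 k - X0 k) ≠ 0) (y0 y1 : ℂ) :
    chain (elementPairFactor f η μ i i' c) X0 X1 m y1 y0 =
      chain (elementPairFactor f η μ i i' c) X0 X1 m y0 y1 := by
  have hL : elementPairFactor f η μ i i' c = fun k => pairFactor f η (c i) (c i) k
      (elementShift c η μ i k) (elementShift c η μ i' k) := by
    funext k
    rw [elementPairFactor, ← hc]
  rw [hL]
  refine chain_symm_of_same hf m (fun k hk => ?_) (fun k => hreg i k)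
    (fun k hk => hreg i' k (hc ▸ hk)) hX y0 y1
  unfold elementShift
  rw [← hc, countBefore_succ hi, countBefore_succ hi, if_pos rfl, if_neg hk.ne]
  push_cast
  ring

/-- Adjacency gives the shifts required by `chain_exchange`: above level c i' those of i and i'
differ by δ and are interchanged with the colours. At level c i' the element of the smaller colour
has shift η - δ when it comes first and -δ when it comes second, the other element then being
counted before it. -/
lemma chain_elementPairFactor_exchange (hf : IsThetaLike f) (hi : (i' : ℕ) = i + 1)
    {c : Fin n → ℕ} {μ : ℕ → ℂ} {X0 X1 : ℕ → ℂ} {m : ℕ} {δ : ℂ} (hc : c i < c i') (hm : c i' ≤ m)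
    (hδ : δ = (μ (c i) - countBefore c (c i) i * η) - (μ (c i') - countBefore c (c i') i * η))
    (hreg : ∀ e k, c e < k → k ≤ m → f (elementShift c η μ e k) ≠ 0)
    (hreg' : ∀ e k, (c ∘ Equiv.swap i i') e < k → k ≤ m →
      f (elementShift (c ∘ Equiv.swap i i') η μ e k) ≠ 0)
    (hXlow : ∀ k, k ≤ c i' → X1 k = X0 k)
    (hX : ∀ k, c i' < k → k ≤ m → f (X1 k - X0 k) ≠ 0) (y0 y1 : ℂ) :
    f δ ≠ 0 ∧
    f (η + y0 - y1) * chain (elementPairFactor f η μ i i' c) X0 X1 m y1 y0 * f δ =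
        f (y0 - y1) *
            chain (elementPairFactor f η μ i i' (c ∘ Equiv.swap i i')) X0 X1 m y0 y1 * f δ +
          f (y0 - y1 + δ) * f η * chain (elementPairFactor f η μ i i' c) X0 X1 m y0 y1 ∧
      f (η + y0 - y1) *
          chain (elementPairFactor f η μ i i' (c ∘ Equiv.swap i i')) X0 X1 m y1 y0 * f δ =
        -(f (η + δ) * f (η - δ)) / f δ ^ 2 * f (y0 - y1) *
            chain (elementPairFactor f η μ i i' c) X0 X1 m y0 y1 * f δ -
          f (y0 - y1 - δ) * f η *
            chain (elementPairFactor f η μ i i' (c ∘ Equiv.swap i i')) X0 X1 m y0 y1 := by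
  set c' := c ∘ Equiv.swap i i' with hc'
  have hne : i ≠ i' := fun h => by rw [h] at hc; exact lt_irrefl _ hc
  have hci : c' i = c i' := by simp [hc']
  have hci' : c' i' = c i := by simp [hc']
  have hcount : ∀ j, countBefore c' j i = countBefore c j i := fun j =>
    countBefore_comp_swap hi c j hne
  have hcount' : ∀ j, countBefore c' j i' = countBefore c j i + if c i' = j then 1 else 0 :=
    fun j => by rw [countBefore_succ hi, hcount, hci]
  have hd1 : ∀ k, c i' < k → elementShift c η μ i' k = elementShift c η μ i k + δ := by
    intro k hk
    unfold elementShift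
    rw [countBefore_succ hi, countBefore_succ hi, if_neg hc.ne, if_neg (hc.trans hk).ne, hδ]
    push_cast
    ring
  have he0 : ∀ k, c i' < k → elementShift c' η μ i k = elementShift c η μ i' k := by
    intro k hk
    unfold elementShift
    rw [hci, hcount, hcount, countBefore_succ hi, countBefore_succ hi, if_neg hc.ne,
      if_neg (hc.trans hk).ne]
    push_cast
    ring
  have he1 : ∀ k, c i' ≠ k → elementShift c' η μ i' k = elementShift c η μ i k := by
    intro k hk
    unfold elementShift
    rw [hci', hcount', hcount', if_neg hc.ne', if_neg hk]
    push_cast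
    ring
  have hd : elementShift c η μ i (c i') = η - δ := by
    unfold elementShift
    rw [hδ]
    ring
  have he : elementShift c' η μ i' (c i') = -δ := by
    unfold elementShift
    rw [hci', hcount', hcount', if_neg hc.ne', if_pos rfl, hδ]
    push_cast
    ring
  -- Regularity of the exchanged colouring suffices, since -δ is one of its shifts.
  have hδ0 : f δ ≠ 0 := by
    have := hreg' i' (c i') (by rw [hci']; exact hc) hm
    rwa [he, hf.neg, neg_ne_zero] at this
  have h := chain_exchange (v := -(f (η + δ) * f (η - δ)) / f δ ^ 2) hf hc m hm
    (d0 := elementShift c η μ i) (d1 := elementShift c η μ i')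
    (e0 := elementShift c' η μ i) (e1 := elementShift c' η μ i')
    (fun k _ hk => he1 k hk.ne') hd he (fun k hk => ⟨hd1 k hk, he0 k hk, he1 k hk.ne⟩) hXlow hX
    (fun k hk => hreg i k (hc.trans_le hk)) (fun k hk => hreg i' k hk) hδ0
    (by field_simp) y0 y1
  have hL : elementPairFactor f η μ i i' c' = fun k => pairFactor f η (c i') (c i) k
      (elementShift c' η μ i k) (elementShift c' η μ i' k) := by
    funext k
    rw [elementPairFactor, hci, hci']
  rw [hL]
  rw [one_mul] at h
  exact ⟨hδ0, h⟩

/-- When both elements are present at level k, the exchange is undone by relabelling the elements at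
that level alone; otherwise T k is unchanged. -/
lemma outerFactor_update {c : Fin n → ℕ} {T : ℕ → Fin n → ℂ} {d : Fin n → ℕ → ℂ} {k : ℕ}
    (hi : (i' : ℕ) = i + 1)
    (hT : ¬(c i < k ∧ c i' < k) → ∀ e, T k (Equiv.swap i i' e) = T k e) (l : ℕ) :
    outerFactor f η i i' d c (Function.update T k (T k ∘ Equiv.swap i i')) l =
      outerFactor f η i i' d c T l := by
  by_cases h : c i < k ∧ c i' < k
  · have hρ : ∀ l, ∃ ρ : Equiv.Perm (Fin n), (ρ = 1 ∨ ρ = Equiv.swap i i') ∧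
        (∀ e, c (ρ e) < l ↔ c e < l) ∧
        ∀ e, Function.update T k (T k ∘ Equiv.swap i i') l (ρ e) = T l e := by
      intro l
      by_cases hl : l = k
      · subst hl
        refine ⟨Equiv.swap i i', .inr rfl, fun e => ?_, fun e => ?_⟩
        · rw [Equiv.swap_apply_def]
          split_ifs with h1 h2
          · simp [h1, h]
          · simp [h2, h]
          · rfl
        · simp
      · exact ⟨1, .inl rfl, fun e => Iff.rfl, fun e => by rw [Function.update_of_ne hl]; rfl⟩
    obtain ⟨ρ, h1, h2, h3⟩ := hρ l
    obtain ⟨ρ', h1', h2', h3'⟩ := hρ (l + 1)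
    exact outerFactor_eq_of_perm hi h1 h1' (fun _ _ => rfl) h2 h2' (fun e _ => h3 e)
      (fun e _ => h3' e)
  · have : T k ∘ Equiv.swap i i' = T k := funext (hT h)
    rw [this, Function.update_eq_self]

end

/-! ### Reduction of the weight functions to two neighbouring elements. -/

namespace BlockPartition

section

variable {n N : ℕ} {lam : Fin N → ℕ} (J : BlockPartition n lam) {i i' : Fin n}

/-- The product of the factors of the weight function of `K` that do not involve only `i`, `i'`. -/
noncomputable def outerProd (τ η : ℂ) (μ : Fin N → ℂ) (i i' : Fin n) (K : BlockPartition n lam)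
    (T : ℕ → Fin n → ℂ) : ℂ :=
  ∏ k ∈ Finset.Ico 1 N,
    outerFactor (theta τ) η i i' (elementShift K.colorNat η (extendParam μ)) K.colorNat T k

/-- In the applications K is J or its image under the exchange. The variables are placed by J in
either case, so that the resulting sums can be compared term by term. -/
lemma two_pow_mul_symmetrize_U (K : BlockPartition n lam) (hi : (i' : ℕ) = i + 1)
    (τ η : ℂ) (μ : Fin N → ℂ) (t : Vars lam) (z : Fin n → ℂ)
    (hplace : ∀ t k a, J.place i i' t z k (K.elt k a) = K.levelVar t z k a)
    (hswap : ∀ t k, ¬(K.colorNat i < k ∧ K.colorNat i' < k) →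
      ∀ e, J.place i i' t z k (Equiv.swap i i' e) = J.place i i' t z k e) :
    2 ^ (N - 1) * symmetrize (fun t' => K.U τ η μ t' z) t =
      ∑ π : (k : Finset.Ico 1 N) → Equiv.Perm (Fin (partialSum lam k)),
        outerProd τ η μ i i' K (J.place i i' (fun k a => t k (π k a)) z) *
          chain (elementPairFactor (theta τ) η (extendParam μ) i i' K.colorNat)
            (fun k => J.place i i' (fun k a => t k (π k a)) z k i)
            (fun k => J.place i i' (fun k a => t k (π k a)) z k i') (N - 1) (z i) (z i') := by
  have hN : N - 1 + 1 = N := by have := (J.color i).2; omega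
  have h := two_pow_mul_sum_eq_chain (i := i) (i' := i')
    (fun π : (k : Finset.Ico 1 N) → Equiv.Perm (Fin (partialSum lam k)) =>
      J.place i i' (fun k a => t k (π k a)) z)
    (elementPairFactor (theta τ) η (extendParam μ) i i' K.colorNat)
    (outerProd τ η μ i i' K) (N - 1) (N - 1) le_rfl
    (fun k h1 h2 => J.exists_place_eq_update z t (Finset.mem_Ico.2 ⟨h1, by omega⟩))
    (fun k h1 h2 π => Finset.prod_congr rfl fun l _ =>
      outerFactor_update hi (fun h => hswap _ k h) l)
  simp only [hN, Finset.Ico_self, Finset.prod_empty, mul_one, place_last] at h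
  rw [← h]
  congr 1
  refine Finset.sum_congr rfl fun π _ => ?_
  beta_reduce
  rw [K.U_eq_prod (T := J.place i i' (fun k a => t k (π k a)) z) (fun k _ _ a => hplace _ k a),
    outerProd, ← Finset.prod_mul_distrib]
  exact Finset.prod_congr rfl fun k _ => prod_levelFactor_eq hi _ _ _ k

lemma place_congr_of_mem (t : Vars lam) (z z' : Fin n → ℂ) {k : ℕ} (hk : k < N) (hk' : 1 ≤ k) :
    J.place i i' t z' k = J.place i i' t z k := by
  have : J.levelVar t z' k = J.levelVar t z k := by
    funext c
    have hk'' : k ∈ Finset.Ico 1 N := Finset.mem_Ico.2 ⟨hk', hk⟩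
    rw [levelVar, levelVar, dif_pos hk'', dif_pos hk'']
  funext e
  simp only [place, this]

lemma colorNat_perm_swap_eq :
    (J.perm (Equiv.swap i i')).colorNat = J.colorNat ∘ Equiv.swap i i' :=
  funext J.colorNat_perm_swap

/-- The relabelling is chosen level by level: trivial where both elements are present, the exchange
where at most one is, and ρ at level N, where the variables are the z's. -/
lemma outerProd_perm_swap (hi : (i' : ℕ) = i + 1) (τ η : ℂ) (μ : Fin N → ℂ) (t : Vars lam)
    (z : Fin n → ℂ) {ρ : Equiv.Perm (Fin n)} (hρ : ρ = 1 ∨ ρ = Equiv.swap i i') :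
    outerProd τ η μ i i' (J.perm (Equiv.swap i i')) (J.place i i' t fun m => z (ρ m)) =
      outerProd τ η μ i i' J (J.place i i' t z) := by
  have hlev : ∀ l, 1 ≤ l → l ≤ N → ∃ ρ' : Equiv.Perm (Fin n), (ρ' = 1 ∨ ρ' = Equiv.swap i i') ∧
      (∀ e, (J.perm (Equiv.swap i i')).colorNat (ρ' e) < l ↔ J.colorNat e < l) ∧
      ∀ e, J.place i i' t (fun m => z (ρ m)) l (ρ' e) = J.place i i' t z l e := by
    intro l h1 hl
    rcases hl.eq_or_lt with rfl | hl
    · refine ⟨ρ, hρ, fun e => ?_, fun e => ?_⟩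
      · exact iff_of_true (Fin.is_lt _) (Fin.is_lt _)
      · rw [place_last, place_last]
        rcases hρ with rfl | rfl
        · rfl
        · rw [Equiv.swap_apply_self]
    · rw [J.place_congr_of_mem t z _ hl h1]
      by_cases h : J.colorNat i < l ∧ J.colorNat i' < l
      · refine ⟨1, .inl rfl, fun e => ?_, fun e => rfl⟩
        rw [colorNat_perm_swap]
        exact J.colorNat_swap_lt_of_both h e
      · refine ⟨Equiv.swap i i', .inr rfl, fun e => ?_, J.place_swap_of_not_both h t z⟩
        rw [colorNat_perm_swap, Equiv.swap_apply_self]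
  refine Finset.prod_congr rfl fun l hl => ?_
  obtain ⟨hl1, hl2⟩ := Finset.mem_Ico.1 hl
  obtain ⟨ρ₁, h1, h2, h3⟩ := hlev l hl1 hl2.le
  obtain ⟨ρ₂, h1', h2', h3'⟩ := hlev (l + 1) (by omega) hl2
  refine outerFactor_eq_of_perm hi h1 h1' (fun e he => ?_) h2 h2' (fun e _ => h3 e)
    (fun e _ => h3' e)
  rw [colorNat_perm_swap_eq]
  exact elementShift_comp_swap hi _ _ _ he

lemma DynRegular.elementShift_ne_zero {J : BlockPartition n lam} {τ η : ℂ} {μ : Fin N → ℂ}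
    (h : J.DynRegular τ η μ) (e : Fin n) (k : ℕ) (he : J.colorNat e < k) (hk : k ≤ N - 1) :
    theta τ (elementShift J.colorNat η (extendParam μ) e k) ≠ 0 := by
  obtain ⟨a, rfl⟩ := J.exists_elt_eq he
  have hk' : k ∈ Finset.Ico 1 N := Finset.mem_Ico.2 ⟨by omega, by omega⟩
  have := h ⟨k, hk'⟩ a
  rwa [dynShift_eq_elementShift] at this

lemma theta_place_sub_ne_zero {τ : ℂ} {t : Vars lam} (ht : OffDiagonal τ t) (z : Fin n → ℂ)
    (hi : i ≠ i') (π : (k : Finset.Ico 1 N) → Equiv.Perm (Fin (partialSum lam k))) {k : ℕ}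
    (h : J.colorNat i < k) (h' : J.colorNat i' < k) (hk : k ≤ N - 1) :
    theta τ (J.place i i' (fun k a => t k (π k a)) z k i' -
      J.place i i' (fun k a => t k (π k a)) z k i) ≠ 0 := by
  obtain ⟨a, ha⟩ := J.exists_elt_eq h
  obtain ⟨b, hb⟩ := J.exists_elt_eq h'
  have hk' : k ∈ Finset.Ico 1 N := Finset.mem_Ico.2 ⟨by omega, by omega⟩
  have hab : a ≠ b := fun hab => hi (by rw [← ha, ← hb, hab])
  have key := ht ⟨k, hk'⟩ (π ⟨k, hk'⟩ a) (π ⟨k, hk'⟩ b) (fun h => hab ((π _).injective h))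
  have h1 := J.place_elt (i := i) (i' := i') (fun k a => t k (π k a)) z k a
  have h2 := J.place_elt (i := i) (i' := i') (fun k a => t k (π k a)) z k b
  rw [levelVar, dif_pos hk'] at h1 h2
  rw [ha] at h1
  rw [hb] at h2
  rwa [h1, h2]

lemma two_pow_mul_symmetrize_U_self (hi : (i' : ℕ) = i + 1)
    (τ η : ℂ) (μ : Fin N → ℂ) (t : Vars lam) (z : Fin n → ℂ) :
    2 ^ (N - 1) * symmetrize (fun t' => J.U τ η μ t' z) t =
      ∑ π : (k : Finset.Ico 1 N) → Equiv.Perm (Fin (partialSum lam k)),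
        outerProd τ η μ i i' J (J.place i i' (fun k a => t k (π k a)) z) *
          chain (elementPairFactor (theta τ) η (extendParam μ) i i' J.colorNat)
            (fun k => J.place i i' (fun k a => t k (π k a)) z k i)
            (fun k => J.place i i' (fun k a => t k (π k a)) z k i') (N - 1) (z i) (z i') :=
  J.two_pow_mul_symmetrize_U J hi τ η μ t z (fun t k a => J.place_elt t z k a)
    (fun t _ h e => J.place_swap_of_not_both h t z e)

lemma two_pow_mul_symmetrize_U_perm_swap (hi : (i' : ℕ) = i + 1)
    (τ η : ℂ) (μ : Fin N → ℂ) (t : Vars lam) (z : Fin n → ℂ) {ρ : Equiv.Perm (Fin n)}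
    (hρ : ρ = 1 ∨ ρ = Equiv.swap i i') :
    2 ^ (N - 1) *
        symmetrize (fun t' => (J.perm (Equiv.swap i i')).U τ η μ t' fun m => z (ρ m)) t =
      ∑ π : (k : Finset.Ico 1 N) → Equiv.Perm (Fin (partialSum lam k)),
        outerProd τ η μ i i' J (J.place i i' (fun k a => t k (π k a)) z) *
          chain (elementPairFactor (theta τ) η (extendParam μ) i i'
              (J.colorNat ∘ Equiv.swap i i'))
            (fun k => J.place i i' (fun k a => t k (π k a)) z k i)
            (fun k => J.place i i' (fun k a => t k (π k a)) z k i') (N - 1)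
            (z (ρ i)) (z (ρ i')) := by
  rw [J.two_pow_mul_symmetrize_U (J.perm (Equiv.swap i i')) hi τ η μ t _
    (fun t k a => J.place_elt_perm_swap hi t _ k a)
    (fun t k h e => J.place_swap_of_not_both (fun h' => h (by
      rw [colorNat_perm_swap, colorNat_perm_swap, Equiv.swap_apply_left, Equiv.swap_apply_right]
      exact h'.symm)) t _ e)]
  refine Finset.sum_congr rfl fun π _ => ?_
  rw [J.outerProd_perm_swap hi τ η μ _ z hρ, colorNat_perm_swap_eq]
  congr 1
  have hX : ∀ k, k ≤ N - 1 → ∀ e, (e = i ∨ e = i') →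
      J.place i i' (fun k a => t k (π k a)) (fun m => z (ρ m)) k e =
        J.place i i' (fun k a => t k (π k a)) z k e := by
    intro k hk e he
    rcases Nat.eq_zero_or_pos k with rfl | hk0
    · simp [place, J.extend_elt_of_not_lt]
    · rw [J.place_congr_of_mem _ z _ (by omega) hk0]
  exact chain_congr (fun k hk => hX k hk i (.inl rfl)) (fun k hk => hX k hk i' (.inr rfl)) _ _

/-! ### The exchange relations for σ = 1. -/

theorem W_swap_of_same (hi : (i' : ℕ) = i + 1) {τ : ℂ} (hτ : 0 < τ.im) {η : ℂ} {μ : Fin N → ℂ}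
    {t : Vars lam} (ht : OffDiagonal τ t) (hμ : J.DynRegular τ η μ)
    (hc : J.color i = J.color i') (z : Fin n → ℂ) :
    (J.perm (Equiv.swap i i')).W τ η μ t (fun m => z (Equiv.swap i i' m)) = J.W τ η μ t z := by
  have hc' : J.colorNat i = J.colorNat i' := congrArg Fin.val hc
  have hne : i ≠ i' := fun h => by rw [h] at hi; omega
  have hcs : J.colorNat ∘ Equiv.swap i i' = J.colorNat := by
    funext e
    rw [Function.comp_apply, Equiv.swap_apply_def]
    split_ifs with h1 h2
    · rw [h1, hc']
    · rw [h2, hc']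
    · rfl
  have h1 := J.two_pow_mul_symmetrize_U_perm_swap hi τ η μ t z (.inr rfl)
  rw [hcs, Equiv.swap_apply_left, Equiv.swap_apply_right] at h1
  have h2 := J.two_pow_mul_symmetrize_U_self hi τ η μ t z
  unfold W
  refine mul_left_cancel₀ (pow_ne_zero (N - 1) two_ne_zero) ?_
  rw [mul_left_comm, h1, mul_left_comm _ (theta τ η ^ _), h2]
  congr 1
  refine Finset.sum_congr rfl fun π _ => ?_
  rw [chain_elementPairFactor_symm (isThetaLike_theta hτ) hi hc'
    (fun e k he hk => hμ.elementShift_ne_zero e k he hk)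
    (fun k hk hk' => J.theta_place_sub_ne_zero ht z hne π hk (hc' ▸ hk) hk')]

/-- Division by the denominators of the R-matrix entries. The two orders of the colours correspond
to the two relations of `chain_elementPairFactor_exchange`, in which δ is always the parameter of
the smaller colour minus that of the larger. -/
lemma ellR_exchange {τ η x : ℂ} {ν : Fin N → ℂ} {a b : Fin N} (hab : a ≠ b)
    {C C' D : ℂ} (hx : theta τ (x + η) ≠ 0) (hν : theta τ (ν a - ν b) ≠ 0)
    (hlt : a < b → theta τ (x + η) * D * theta τ (ν a - ν b) =
      -(theta τ (η + (ν a - ν b)) * theta τ (η - (ν a - ν b))) / theta τ (ν a - ν b) ^ 2 *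
          theta τ x * C * theta τ (ν a - ν b) - theta τ (x - (ν a - ν b)) * theta τ η * C')
    (hgt : b < a → theta τ (x + η) * D * theta τ (ν b - ν a) =
      theta τ x * C * theta τ (ν b - ν a) + theta τ (x + (ν b - ν a)) * theta τ η * C') :
    D = ellR τ η x ν a b a b * C + ellR τ η x ν a b b a * C' := by
  have hneg : theta τ (ν b - ν a) = -theta τ (ν a - ν b) := by rw [← theta_neg, neg_sub]
  have e1 : η + ν a - ν b = η + (ν a - ν b) := by ring
  have e2 : η + ν b - ν a = η - (ν a - ν b) := by ring
  have e3 : x + ν b - ν a = x - (ν a - ν b) := by ring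
  have e4 : x + (ν b - ν a) = x - (ν a - ν b) := by ring
  simp only [ellR, if_neg hab, hab.symm, and_self, if_true, false_and, if_false]
  rcases lt_or_gt_of_ne hab with h | h
  · have := hlt h
    rw [if_pos h, hneg, e1, e2, e3]
    field_simp at this ⊢
    linear_combination this
  · have := hgt h
    rw [if_neg h.not_gt, hneg, e3]
    rw [hneg, e4] at this
    field_simp at this ⊢
    linear_combination -this

theorem W_swap_of_ne (hi : (i' : ℕ) = i + 1) {τ : ℂ} (hτ : 0 < τ.im) {η : ℂ} {μ : Fin N → ℂ}
    {t : Vars lam} (ht : OffDiagonal τ t) (hμ : J.DynRegular τ η μ)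
    (hμ' : (J.perm (Equiv.swap i i')).DynRegular τ η μ)
    (hc : J.color i ≠ J.color i') (z : Fin n → ℂ) (hz : theta τ (z i - z i' + η) ≠ 0)
    (hν : theta τ (J.shiftedμ i η μ (J.color i) - J.shiftedμ i η μ (J.color i')) ≠ 0) :
    (J.perm (Equiv.swap i i')).W τ η μ t (fun m => z (Equiv.swap i i' m)) =
      ellR τ η (z i - z i') (J.shiftedμ i η μ) (J.color i) (J.color i') (J.color i) (J.color i') *
          J.W τ η μ t z +
        ellR τ η (z i - z i') (J.shiftedμ i η μ) (J.color i) (J.color i') (J.color i')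
          (J.color i) * (J.perm (Equiv.swap i i')).W τ η μ t z := by
  have hne : i ≠ i' := fun h => by rw [h] at hi; omega
  have h1 := J.two_pow_mul_symmetrize_U_perm_swap hi τ η μ t z (.inr rfl)
  rw [Equiv.swap_apply_left, Equiv.swap_apply_right] at h1
  have h2 := J.two_pow_mul_symmetrize_U_self hi τ η μ t z
  have h3 := J.two_pow_mul_symmetrize_U_perm_swap hi τ η μ t z (.inl rfl)
  simp only [Equiv.Perm.one_apply] at h3
  have hνc : ∀ j : Fin N, J.shiftedμ i η μ j =
      extendParam μ j - countBefore J.colorNat j i * η := fun j => by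
    rw [shiftedμ, p_eq_countBefore, extendParam_val]
  have hreg : ∀ e k, J.colorNat e < k → k ≤ N - 1 →
      theta τ (elementShift J.colorNat η (extendParam μ) e k) ≠ 0 := hμ.elementShift_ne_zero
  have hreg' := hμ'.elementShift_ne_zero
  rw [colorNat_perm_swap_eq] at hreg'
  have hss : (J.colorNat ∘ Equiv.swap i i') ∘ Equiv.swap i i' = J.colorNat := by
    funext e; simp
  have hswap : ∀ t k, ¬(J.colorNat i < k ∧ J.colorNat i' < k) →
      J.place i i' t z k i' = J.place i i' t z k i := fun t k h => by
    have := J.place_swap_of_not_both h t z i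
    rwa [Equiv.swap_apply_left] at this
  unfold W
  refine mul_left_cancel₀ (pow_ne_zero (N - 1) two_ne_zero) ?_
  rw [mul_left_comm, h1]
  have hsum : ∀ R R' E A B : ℂ, 2 ^ (N - 1) * (R * (E * A) + R' * (E * B)) =
    E * (R * (2 ^ (N - 1) * A) + R' * (2 ^ (N - 1) * B)) := fun _ _ _ _ _ => by ring
  rw [hsum, h2, h3]
  congr 1
  rw [Finset.mul_sum, Finset.mul_sum, ← Finset.sum_add_distrib]
  refine Finset.sum_congr rfl fun π _ => ?_
  rw [mul_left_comm, mul_left_comm _ (outerProd _ _ _ _ _ _ _), ← mul_add]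
  congr 1
  have hX : ∀ k, J.colorNat i < k → J.colorNat i' < k → k ≤ N - 1 → _ :=
    fun k hk hk' => J.theta_place_sub_ne_zero ht z hne π hk hk'
  refine ellR_exchange hc hz hν (fun hlt => ?_) (fun hlt => ?_)
  · have hlt' : J.colorNat i < J.colorNat i' := hlt
    have h := (chain_elementPairFactor_exchange (isThetaLike_theta hτ) hi hlt'
      (m := N - 1) (by have := (J.color i').2; unfold colorNat; omega) rfl hreg hreg'
      (fun k hk => hswap _ k (by omega)) (fun k hk hk' => hX k (hlt'.trans hk) hk hk')
      (z i) (z i')).2.2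
    rw [show η + z i - z i' = z i - z i' + η by ring] at h
    rw [hνc, hνc]
    exact h
  · have hlt' : J.colorNat i' < J.colorNat i := hlt
    -- The pair lemma is applied to the exchanged colouring, in which the smaller colour comes
    -- first; the dynamical parameters at i are the same for both colourings.
    have hcnt : ∀ j, countBefore (J.colorNat ∘ Equiv.swap i i') j i =
      countBefore J.colorNat j i := fun j => countBefore_comp_swap hi _ j hne
    have h := (chain_elementPairFactor_exchange (c := J.colorNat ∘ Equiv.swap i i')
      (isThetaLike_theta hτ) hi (by simpa using hlt')
      (m := N - 1) (by have := (J.color i).2; simp only [Function.comp_apply,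
        Equiv.swap_apply_right]; unfold colorNat; omega) rfl hreg' (by rw [hss]; exact hreg)
      (fun k hk => hswap _ k (by
        simp only [Function.comp_apply, Equiv.swap_apply_right] at hk; omega))
      (fun k hk hk' => hX k (by simpa using hk) (by
        simp only [Function.comp_apply, Equiv.swap_apply_right] at hk; omega) hk')
      (z i) (z i')).2.1
    rw [show η + z i - z i' = z i - z i' + η by ring, hss] at h
    simp only [Function.comp_apply, Equiv.swap_apply_right, Equiv.swap_apply_left, hcnt] at h
    rw [hνc, hνc]
    exact h

end

end BlockPartition

end EllipticWeight

/-! ### The theorem for arbitrary σ. -/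

theorem theorem2p2
    (τ : ℂ) (hτ : 0 < τ.im) (N n : ℕ) (lam : Fin N → ℕ) (I : BlockPartition n lam)
    (σ : Equiv.Perm (Fin n)) (i i' : Fin n) (hi : (i' : ℕ) = (i : ℕ) + 1)
    (a b : Fin N) (ha : σ i ∈ I.block a) (hb : σ i' ∈ I.block b)
    (η : ℂ) (μ : Fin N → ℂ) (t : Vars lam) (z : Fin n → ℂ)
    (ht : OffDiagonal τ t) (hμ : (I.perm σ⁻¹).DynRegular τ η μ) :
    (a = b →
      I.Wσ (σ * Equiv.swap i i') τ η μ t z = I.Wσ σ τ η μ t z) ∧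
    (a ≠ b →
      (I.perm (σ * Equiv.swap i i')⁻¹).DynRegular τ η μ →
      theta τ (z (σ i) - z (σ i') + η) ≠ 0 →
      theta τ ((I.perm σ⁻¹).shiftedμ i η μ a - (I.perm σ⁻¹).shiftedμ i η μ b) ≠ 0 →
      I.Wσ (σ * Equiv.swap i i') τ η μ t z =
        ellR τ η (z (σ i) - z (σ i')) ((I.perm σ⁻¹).shiftedμ i η μ) a b a b
            * I.Wσ σ τ η μ t z
          + ellR τ η (z (σ i) - z (σ i')) ((I.perm σ⁻¹).shiftedμ i η μ) a b b a
            * (I.perm (Equiv.swap (σ i) (σ i'))).Wσ σ τ η μ t z) := by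
  set J := I.perm σ⁻¹ with hJ
  have hcol : ∀ m, J.color m = I.color (σ m) := fun m => by simp [hJ, BlockPartition.perm]
  have hperm : I.perm (σ * Equiv.swap i i')⁻¹ = J.perm (Equiv.swap i i') := by
    ext m
    simp [hJ, BlockPartition.perm]
  -- The transposition of σ(i) and σ(i') is conjugate under σ to that of i and i', so the three
  -- weight functions belong to J and its image under the exchange.
  have hperm' : (I.perm (Equiv.swap (σ i) (σ i'))).perm σ⁻¹ = J.perm (Equiv.swap i i') := by
    ext m
    simp [hJ, BlockPartition.perm, σ.injective.swap_apply]
  have ha' : J.color i = a := by rw [hcol]; simpa [BlockPartition.block] using ha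
  have hb' : J.color i' = b := by rw [hcol]; simpa [BlockPartition.block] using hb
  subst ha' hb'
  unfold BlockPartition.Wσ
  rw [hperm, hperm', ← hJ]
  refine ⟨fun hab => ?_, fun hab hμ' hz hν => ?_⟩
  · exact J.W_swap_of_same hi hτ ht hμ hab fun m => z (σ m)
  · exact J.W_swap_of_ne hi hτ ht hμ hμ' hab (fun m => z (σ m)) hz hν
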